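/- Let $x_1,\dots,x_n\in\mathbb R^d$ ($n\ge 1$) with $\|x_i\|_2=1$, and let $y\in\mathbb R^n$ with $|y_i|\le C$ for all $i$. Put $$H^\infty_{ij}=\mathbb E_{w\sim N(0,I)}\big[x_i^\top x_j\,\mathbb 1\{w^\top x_i\ge 0,\ w^\top x_j\ge 0\}\big],\qquad \lambda_0=\lambda_{\min}(H^\infty),$$ and assume $\lambda_0>0$. For $W=(w_1,\dots,w_m)\in(\mathbb R^d)^m$ and $a\in\mathbb R^m$ let $$f(W,a,x)=\frac1{\sqrt m}\sum_{r=1}^m a_r\,\sigma(w_r^\top x),\qquad \sigma(z)=\max(z,0),\qquad L(W,a)=\frac12\sum_{i=1}^n\big(f(W,a,x_i)-y_i\big)^2 .$$ A gradient flow of $L$ training both layers on $[0,T]$ is an absolutely continuous curve $t\mapsto(W(t),a(t))$ such that for almost every $t\in[0,T]$ there are $c_{ri}\in[0,1]$, with $c_{ri}=1$ if $w_r(t)^\top x_i>0$ and $c_{ri}=0$ if $w_r(t)^\top x_i<0$, such that for all $r$ $$\dot w_r(t)=-\frac1{\sqrt m}\sum_{i=1}^n (u_i(t)-y_i)\,a_r(t)\,c_{ri}\,x_i,\qquad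 \dot a_r(t)=-\frac1{\sqrt m}\sum_{i=1}^n (u_i(t)-y_i)\,\sigma(w_r(t)^\top x_i),$$ where $u_i(t)=f(W(t),a(t),x_i)$ and $u(t)=(u_1(t),\dots,u_n(t))$. (The choice $c_{ri}=\mathbb 1\{w_r^\top x_i\ge 0\}$ gives the usual gradient formula.) **Theorem.** For every $C$ there is a constant $K>0$, depending only on $C$, such that the following holds for all $n$, $d$, $(x_i)$, $y$ as above, all $\delta\in(0,1)$ and all integers $m\ge 2$ with $$m\ \ge\ K\,\frac{n^6\log(m/\delta)}{\lambda_0^4\,\delta^3}.$$ Let $w_r(0)\sim N(0,I)$ and $a_r(0)\sim\mathrm{unif}\{-1,1\}$, $r=1,\dots,m$, all independent. Then with probability at least $1-\delta$ over this initialization, for every $T\ge 0$, every gradient flow on $[0,T]$ from the initialization, every $t\in[0,T]$ and every $r$, $$\|u(t)-y\|_2^2\le e^{-\lambda_0 t}\,\|u(0)-y\|_2^2,$$ $$\|w_r(t)-w_r(0)\|_2\le\frac{4\sqrt n\,\|y-u(0)\|_2}{\sqrt m\,\lambda_0},\qquad |a_r(t)-a_r(0)|\le\frac{8\sqrt n\,\|y-u(0)\|_2\sqrt{\log(mn/\delta)}}{\sqrt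 m\,\lambda_0}.$$ -/

import Mathlib

open MeasureTheory ProbabilityTheory
open scoped RealInnerProductSpace

noncomputable section

namespace TwoLayerReLU

/-- The ReLU activation `z ↦ z` for `z ≥ 0`, `z ↦ 0` for `z < 0`. -/
def relu (z : ℝ) : ℝ := max z 0

/-- The set of admissible slopes of the ReLU at `z`: `{1}` for `z > 0`, `{0}` for `z < 0` and the
whole interval `[0, 1]` at the kink `z = 0` (the subdifferential of the ReLU). -/
def reluSlope (z : ℝ) : Set ℝ :=
  {c | 0 ≤ c ∧ c ≤ 1 ∧ (0 < z → c = 1) ∧ (z < 0 → c = 0)}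

variable {n m d : ℕ}

/-- The network `f(W, a, x) = m^{-1/2} ∑ r, a_r relu (w_r ⬝ x)`. -/
def net (W : Fin m → EuclideanSpace ℝ (Fin d)) (a : Fin m → ℝ)
    (x : EuclideanSpace ℝ (Fin d)) : ℝ :=
  1 / Real.sqrt m * ∑ r, a r * relu ⟪W r, x⟫

/-- The vector `u ∈ ℝⁿ` of predictions on the inputs `x_1, …, x_n`. -/
def prediction (x : Fin n → EuclideanSpace ℝ (Fin d))
    (W : Fin m → EuclideanSpace ℝ (Fin d)) (a : Fin m → ℝ) : EuclideanSpace ℝ (Fin n) :=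
  WithLp.toLp 2 fun i => net W a (x i)

/-- The derivative of the loss `L(W, a) = ∑ i, (f(W, a, x_i) - y_i)² / 2` in the direction `w_r`,
`m^{-1/2} ∑ i, (f(W, a, x_i) - y_i) a_r c_i x_i`, where `c_i` is the slope used for the ReLU at
`w_r ⬝ x_i`. With `c_i = 𝟙{w_r ⬝ x_i ≥ 0}` it is the usual gradient formula. -/
def gradW (x : Fin n → EuclideanSpace ℝ (Fin d)) (y : EuclideanSpace ℝ (Fin n))
    (W : Fin m → EuclideanSpace ℝ (Fin d)) (a : Fin m → ℝ) (c : Fin n → ℝ) (r : Fin m) :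
    EuclideanSpace ℝ (Fin d) :=
  (1 / Real.sqrt m) • ∑ i, ((net W a (x i) - y i) * a r * c i) • x i

/-- The derivative of the loss in the direction `a_r`,
`m^{-1/2} ∑ i, (f(W, a, x_i) - y_i) relu (w_r ⬝ x_i)`. -/
def gradA (x : Fin n → EuclideanSpace ℝ (Fin d)) (y : EuclideanSpace ℝ (Fin n))
    (W : Fin m → EuclideanSpace ℝ (Fin d)) (a : Fin m → ℝ) (r : Fin m) : ℝ :=
  1 / Real.sqrt m * ∑ i, (net W a (x i) - y i) * relu ⟪W r, x i⟫

/-- `(W, a)` is a gradient flow of the loss in both layers on the time interval `[0, T]`: the curve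
is absolutely continuous and at almost every time
`w_r' = - ∂L/∂w_r` and `a_r' = - ∂L/∂a_r` for all `r`. As the loss is not differentiable where some
`w_r ⬝ x_i = 0`, this is a differential inclusion: every slope in `[0, 1]` is allowed for the ReLU
at its kink. In particular all solutions of the equation with the convention `𝟙{w_r ⬝ x_i ≥ 0}`
are included. -/
structure IsGradientFlow (x : Fin n → EuclideanSpace ℝ (Fin d)) (y : EuclideanSpace ℝ (Fin n))
    (T : ℝ) (W : ℝ → Fin m → EuclideanSpace ℝ (Fin d)) (a : ℝ → Fin m → ℝ) : Prop where
  absCont_W : ∀ r, AbsolutelyContinuousOnInterval (fun t => W t r) 0 T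
  absCont_a : ∀ r, AbsolutelyContinuousOnInterval (fun t => a t r) 0 T
  deriv_W : ∀ᵐ t ∂(volume.restrict (Set.Icc 0 T)), ∃ c : Fin m → Fin n → ℝ,
    (∀ r i, c r i ∈ reluSlope ⟪W t r, x i⟫) ∧
    ∀ r, HasDerivAt (fun s => W s r) (-gradW x y (W t) (a t) (c r) r) t
  deriv_a : ∀ᵐ t ∂(volume.restrict (Set.Icc 0 T)),
    ∀ r, HasDerivAt (fun s => a s r) (-gradA x y (W t) (a t) r) t

open scoped Classical in
/-- The Gram matrix
`H^∞_{ij} = 𝔼_{w ∼ N(0, I)} [x_i ⬝ x_j 𝟙{w ⬝ x_i ≥ 0, w ⬝ x_j ≥ 0}]`. -/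
def gramInf (x : Fin n → EuclideanSpace ℝ (Fin d)) : Matrix (Fin n) (Fin n) ℝ :=
  Matrix.of fun i j =>
    ∫ w, ⟪x i, x j⟫ * (if 0 ≤ ⟪w, x i⟫ ∧ 0 ≤ ⟪w, x j⟫ then 1 else 0)
      ∂(stdGaussian (EuclideanSpace ℝ (Fin d)))

/-- The smallest eigenvalue of a real symmetric matrix (of size at least one); the spectrum is then
a finite nonempty set of reals. -/
def lambdaMin (A : Matrix (Fin n) (Fin n) ℝ) : ℝ := sInf (spectrum ℝ A)

/-- The law of the random initialization: `w_1, …, w_m ∼ N(0, I)` and `a_1, …, a_m` uniform on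
`{-1, 1}`, all independent. -/
def initLaw (m d : ℕ) : Measure ((Fin m → EuclideanSpace ℝ (Fin d)) × (Fin m → ℝ)) :=
  (Measure.pi fun _ => stdGaussian (EuclideanSpace ℝ (Fin d))).prod
    (Measure.pi fun _ => uniformOn ({-1, 1} : Set ℝ))

end TwoLayerReLU

end

/-!
Along the flow the squared residual `‖u - y‖²` decreases at twice the rate
`∑ r, ‖∂L/∂w_r‖² + ∑ r, |∂L/∂a_r|²`. The first sum is
`m⁻¹ ∑ r, a_r² ‖∑ i, (u_i - y_i) c_{ri} x_i‖²`, which at initialization is the quadratic form of the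
empirical Gram matrix, a matrix close to `H^∞`. It can only degrade through neurons whose weights
move by as much as their distance to a kink or through second-layer weights that drift from `±1`. So
as long as every `w_r` stays within `R` and every `a_r` within `1/8` of its initial value, the
residual decays exponentially; integrating the resulting bound on the speeds shows that these radii
are never reached once `m` is large, and a continuity argument turns this into a bound for all
times. The closeness of the Gram matrices, the small number of neurons near a kink, and the bounds
on the initial preactivations and outputs each fail with probability at most `δ / 4`.
-/

namespace TwoLayerReLU

/-! ### Absolutely continuous curves -/

section AbsolutelyContinuous

variable {E : Type*} [NormedAddCommGroup E] {a b : ℝ}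

theorem absolutelyContinuousOnInterval_comp_lipschitzWith {X Y : Type*} [PseudoMetricSpace X]
    [PseudoMetricSpace Y] {f : ℝ → X} {g : X → Y} {K : NNReal} (hg : LipschitzWith K g)
    (hf : AbsolutelyContinuousOnInterval f a b) :
    AbsolutelyContinuousOnInterval (fun t => g (f t)) a b := by
  refine squeeze_zero (fun t => Finset.sum_nonneg fun i _ => dist_nonneg) (fun t => ?_)
    (by simpa using Filter.Tendsto.const_mul (K : ℝ) hf)
  rw [Finset.mul_sum]
  exact Finset.sum_le_sum fun i _ => hg.dist_le_mul _ _

theorem absolutelyContinuousOnInterval_const {X : Type*} [PseudoMetricSpace X] (c : X) (a b : ℝ) :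
    AbsolutelyContinuousOnInterval (fun _ => c) a b :=
  (LipschitzWith.const c).lipschitzOnWith.absolutelyContinuousOnInterval

theorem absolutelyContinuousOnInterval_sum {ι : Type*} (s : Finset ι) {f : ι → ℝ → E}
    (hf : ∀ i ∈ s, AbsolutelyContinuousOnInterval (f i) a b) :
    AbsolutelyContinuousOnInterval (fun t => ∑ i ∈ s, f i t) a b := by
  classical
  induction s using Finset.induction_on with
  | empty => simpa using absolutelyContinuousOnInterval_const (0 : E) a b
  | insert i s hi ih =>
    simp only [Finset.sum_insert hi]
    exact (hf i (Finset.mem_insert_self i s)).fun_add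
      (ih fun j hj => hf j (Finset.mem_insert_of_mem hj))

theorem absolutelyContinuousOnInterval_inner_const [InnerProductSpace ℝ E] {f : ℝ → E}
    (hf : AbsolutelyContinuousOnInterval f a b) (v : E) :
    AbsolutelyContinuousOnInterval (fun t => ⟪f t, v⟫) a b := by
  simpa only [innerSL_apply_apply, real_inner_comm] using
    absolutelyContinuousOnInterval_comp_lipschitzWith (innerSL ℝ v).lipschitz hf

theorem le_of_ae_deriv_nonpos {f : ℝ → ℝ} (hab : a ≤ b)
    (hf : AbsolutelyContinuousOnInterval f a b)
    (hd : ∀ᵐ t ∂volume.restrict (Set.Ico a b), deriv f t ≤ 0) : f b ≤ f a := by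
  have h : 0 ≤ ∫ t in a..b, -deriv f t := by
    refine intervalIntegral.integral_nonneg_of_ae_restrict hab ?_
    rw [← restrict_Ico_eq_restrict_Icc]
    filter_upwards [hd] with t ht using neg_nonneg.2 ht
  rw [intervalIntegral.integral_neg, hf.integral_deriv_eq_sub] at h
  linarith

theorem ae_restrict_Ico_differentiableAt {f : ℝ → ℝ} (hab : a ≤ b)
    (hf : AbsolutelyContinuousOnInterval f a b) :
    ∀ᵐ t ∂volume.restrict (Set.Ico a b), DifferentiableAt ℝ f t := by
  refine (ae_restrict_iff' measurableSet_Ico).2 ?_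
  filter_upwards [hf.ae_differentiableAt] with t ht hts
  exact ht (Set.uIcc_of_le hab ▸ Set.Ico_subset_Icc_self hts)

theorem norm_sub_le_of_ae_norm_deriv_le [NormedSpace ℝ E] {f : ℝ → E} {g : ℝ → ℝ} (hab : a ≤ b)
    (hf : AbsolutelyContinuousOnInterval f a b) (hg : AbsolutelyContinuousOnInterval g a b)
    (hd : ∀ᵐ t ∂volume.restrict (Set.Ico a b), ∃ f', HasDerivAt f f' t ∧ ‖f'‖ ≤ deriv g t) :
    ‖f b - f a‖ ≤ g b - g a := by
  obtain ⟨φ, hφ, hφv⟩ := exists_dual_vector'' ℝ (f b - f a)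
  have hle : φ (f b) - g b ≤ φ (f a) - g a := by
    refine le_of_ae_deriv_nonpos hab
      ((absolutelyContinuousOnInterval_comp_lipschitzWith φ.lipschitz hf).fun_sub hg) ?_
    filter_upwards [hd, ae_restrict_Ico_differentiableAt hab hg] with t ⟨f', hf', hle⟩ hgt
    have hderiv : HasDerivAt (fun s => φ (f s) - g s) (φ f' - deriv g t) t :=
      (φ.hasFDerivAt.comp_hasDerivAt t hf').sub hgt.hasDerivAt
    rw [hderiv.deriv, sub_nonpos]
    calc φ f' ≤ ‖φ f'‖ := le_abs_self _
      _ ≤ 1 * ‖f'‖ := φ.le_of_opNorm_le hφ f'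
      _ ≤ deriv g t := by rwa [one_mul]
  have hnorm : φ (f b) - φ (f a) = ‖f b - f a‖ := by rw [← map_sub]; exact hφv
  linarith

theorem norm_sub_le_of_ae_norm_deriv_le_exp [NormedSpace ℝ E] {f : ℝ → E} {B μ : ℝ} (hb : 0 ≤ b)
    (hB : 0 ≤ B) (hμ : 0 < μ) (hf : AbsolutelyContinuousOnInterval f 0 b)
    (hd : ∀ᵐ t ∂volume.restrict (Set.Ico 0 b),
      ∃ f', HasDerivAt f f' t ∧ ‖f'‖ ≤ B * Real.exp (-μ * t)) :
    ‖f b - f 0‖ ≤ B / μ := by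
  have hderiv : ∀ t, deriv (fun t => -(B / μ) * Real.exp (-μ * t)) t = B * Real.exp (-μ * t) := by
    intro t
    have h := (((hasDerivAt_id' t).const_mul (-μ)).exp).const_mul (-(B / μ))
    rw [h.deriv]
    field_simp
  have h := norm_sub_le_of_ae_norm_deriv_le (g := fun t => -(B / μ) * Real.exp (-μ * t)) hb hf
    (ContDiffOn.absolutelyContinuousOnInterval (by fun_prop)) (by simpa only [hderiv] using hd)
  have hpos : 0 ≤ B / μ * Real.exp (-μ * b) := by positivity
  rw [mul_zero, Real.exp_zero] at h
  linarith

theorem le_exp_mul_of_ae_deriv_le {f : ℝ → ℝ} {μ : ℝ} (hb : 0 ≤ b)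
    (hf : AbsolutelyContinuousOnInterval f 0 b)
    (hd : ∀ᵐ t ∂volume.restrict (Set.Ico 0 b), deriv f t ≤ -μ * f t) :
    f b ≤ Real.exp (-μ * b) * f 0 := by
  have hle : Real.exp (μ * b) * f b ≤ Real.exp (μ * 0) * f 0 := by
    have hexp : AbsolutelyContinuousOnInterval (fun t => Real.exp (μ * t)) 0 b :=
      ContDiffOn.absolutelyContinuousOnInterval (by fun_prop)
    refine le_of_ae_deriv_nonpos hb (hexp.fun_mul hf) ?_
    filter_upwards [hd, ae_restrict_Ico_differentiableAt hb hf] with t ht hft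
    rw [((((hasDerivAt_id' t).const_mul μ).exp).fun_mul hft.hasDerivAt).deriv]
    have := mul_le_mul_of_nonneg_left ht (Real.exp_pos (μ * t)).le
    linarith
  rw [mul_zero, Real.exp_zero, one_mul] at hle
  rwa [neg_mul, Real.exp_neg, ← div_eq_inv_mul, le_div_iff₀' (Real.exp_pos _)]

end AbsolutelyContinuous

theorem forall_mem_Icc_of_forall_Ico_imp {α : Type*} [ConditionallyCompleteLinearOrder α]
    [TopologicalSpace α] [OrderTopology α] {P : α → Prop} {a b : α}
    (hc : IsClosed {t | t ∈ Set.Icc a b ∧ ¬ P t})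
    (h : ∀ t ∈ Set.Icc a b, (∀ s ∈ Set.Ico a t, P s) → P t) : ∀ t ∈ Set.Icc a b, P t := by
  by_contra! hne
  have hcomp : IsCompact {t | t ∈ Set.Icc a b ∧ ¬ P t} :=
    isCompact_Icc.of_isClosed_subset hc fun _ h => h.1
  obtain ⟨t₀, ⟨ht₀, hP₀⟩, hmin⟩ := hcomp.exists_isLeast hne
  refine hP₀ (h t₀ ht₀ fun s hs => ?_)
  by_contra hPs
  exact (hmin ⟨⟨hs.1, hs.2.le.trans ht₀.2⟩, hPs⟩).not_gt hs.2

/-! ### The ReLU and its slopes -/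

theorem lipschitzWith_relu : LipschitzWith 1 relu :=
  LipschitzWith.id.max_const 0

@[fun_prop]
theorem measurable_relu : Measurable relu := lipschitzWith_relu.continuous.measurable

theorem abs_relu_le (z : ℝ) : |relu z| ≤ |z| := by
  rw [relu, abs_of_nonneg (le_max_right z 0)]
  exact max_le (le_abs_self z) (abs_nonneg z)

theorem abs_le_one_of_mem_reluSlope {z c : ℝ} (hc : c ∈ reluSlope z) : |c| ≤ 1 :=
  abs_le.2 ⟨by linarith [hc.1], hc.2.1⟩

theorem hasDerivAt_relu_comp {g : ℝ → ℝ} {t v c : ℝ} (hg : HasDerivAt g v t)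
    (hr : DifferentiableAt ℝ (fun s => relu (g s)) t) (hc : c ∈ reluSlope (g t)) :
    HasDerivAt (fun s => relu (g s)) (c * v) t := by
  obtain ⟨-, -, hpos, hneg⟩ := hc
  rcases lt_trichotomy (g t) 0 with h | h | h
  · rw [hneg h, zero_mul]
    refine (hasDerivAt_const t (0 : ℝ)).congr_of_eventuallyEq ?_
    filter_upwards [hg.continuousAt.eventually_lt continuousAt_const h] with s hs
      using max_eq_right hs.le
  · -- At the kink `relu ∘ g` and `relu ∘ g - g` are minimal, so differentiability forces `v = 0`.
    have hmin : IsLocalMin (fun s => relu (g s)) t :=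
      Filter.Eventually.of_forall fun s => by simp [relu, h]
    have hmin' : IsLocalMin (fun s => relu (g s) - g s) t :=
      Filter.Eventually.of_forall fun s => by simp [relu, h]
    have h0 := hmin.hasDerivAt_eq_zero hr.hasDerivAt
    have hv : v = 0 := by
      linarith [hmin'.hasDerivAt_eq_zero (hr.hasDerivAt.sub hg)]
    rw [hv, mul_zero, ← h0]
    exact hr.hasDerivAt
  · rw [hpos h, one_mul]
    refine hg.congr_of_eventuallyEq ?_
    filter_upwards [continuousAt_const.eventually_lt hg.continuousAt h] with s hs
      using max_eq_left hs.le

/-- The slope `𝟙{z ≥ 0}` of the ReLU. -/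
noncomputable def step (z : ℝ) : ℝ := if 0 ≤ z then 1 else 0

@[fun_prop]
theorem measurable_step : Measurable step :=
  Measurable.ite measurableSet_Ici measurable_const measurable_const

theorem abs_step_le_one (z : ℝ) : |step z| ≤ 1 := by
  unfold step
  split_ifs <;> simp

/-- The indicator of `|z| ≤ R`: a neuron moving by at most `R` can cross the kink of the ReLU at a
unit input only if its initial preactivation `z` satisfies this inequality. -/
noncomputable def nearZero (R z : ℝ) : ℝ := if |z| ≤ R then 1 else 0

@[fun_prop]
theorem measurable_nearZero (R : ℝ) : Measurable (nearZero R) :=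
  Measurable.ite (measurableSet_le (by fun_prop) measurable_const) measurable_const measurable_const

theorem nearZero_nonneg (R z : ℝ) : 0 ≤ nearZero R z := by
  unfold nearZero
  split_ifs <;> simp

theorem abs_step_sub_slope_le {z z' c R : ℝ} (hc : c ∈ reluSlope z') (h : |z' - z| ≤ R) :
    |step z - c| ≤ nearZero R z := by
  obtain ⟨h0, h1, hpos, hneg⟩ := hc
  obtain ⟨hl, hu⟩ := abs_le.1 h
  unfold step nearZero
  by_cases hz : |z| ≤ R
  · rw [if_pos hz, abs_le]
    split_ifs <;> constructor <;> linarith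
  · rw [if_neg hz]
    rcases lt_abs.1 (not_le.1 hz) with hz | hz
    · rw [if_pos (by linarith), hpos (by linarith), sub_self, abs_zero]
    · rw [if_neg (by linarith), hneg (by linarith), sub_self, abs_zero]

/-! ### Gated sums -/

section GatedSum

variable {ι E : Type*} [Fintype ι] [NormedAddCommGroup E]

theorem norm_sum_smul_le [NormedSpace ℝ E] (v : EuclideanSpace ℝ ι) {z : ι → E} {M : ℝ}
    (hz : ∀ i, ‖z i‖ ≤ M) : ‖∑ i, v i • z i‖ ≤ Real.sqrt (Fintype.card ι) * ‖v‖ * M := by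
  rcases isEmpty_or_nonempty ι with _ | ⟨⟨i₀⟩⟩
  · simp
  have hl1 : ∑ i, |v i| ≤ Real.sqrt (Fintype.card ι) * ‖v‖ := by
    refine abs_le_of_sq_le_sq' ?_ (by positivity) |>.2
    rw [mul_pow, Real.sq_sqrt (Nat.cast_nonneg _), EuclideanSpace.real_norm_sq_eq]
    simpa only [Finset.card_univ, sq_abs] using
      sq_sum_le_card_mul_sum_sq (s := Finset.univ) (f := fun i => |v i|)
  calc ‖∑ i, v i • z i‖ ≤ ∑ i, |v i| * M :=
        norm_sum_le_of_le _ fun i _ => by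
          rw [norm_smul, Real.norm_eq_abs]
          exact mul_le_mul_of_nonneg_left (hz i) (abs_nonneg _)
    _ = (∑ i, |v i|) * M := (Finset.sum_mul _ _ _).symm
    _ ≤ _ := mul_le_mul_of_nonneg_right hl1 ((norm_nonneg _).trans (hz i₀))

variable [InnerProductSpace ℝ E] {x : ι → E} {c : ι → ℝ}

/-- The combination `∑ i, v_i c_i x_i` of the inputs that reaches a neuron whose ReLU has slope
`c_i` at the input `x_i`. For the residual `v = u - y` it is, up to the factor `a_r / √m`, the
gradient in `w_r`. -/
def gatedSum (x : ι → E) (v : EuclideanSpace ℝ ι) (c : ι → ℝ) : E := ∑ i, v i • c i • x i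

theorem norm_gatedSum_le (hx : ∀ i, ‖x i‖ ≤ 1) (v : EuclideanSpace ℝ ι) (hc : ∀ i, |c i| ≤ 1) :
    ‖gatedSum x v c‖ ≤ Real.sqrt (Fintype.card ι) * ‖v‖ := by
  rw [← mul_one (_ * ‖v‖)]
  refine norm_sum_smul_le v fun i => ?_
  rw [norm_smul, Real.norm_eq_abs]
  exact mul_le_one₀ (hc i) (norm_nonneg _) (hx i)

theorem norm_gatedSum_sub_le (hx : ∀ i, ‖x i‖ ≤ 1) (v : EuclideanSpace ℝ ι) {s b : ι → ℝ}
    (h : ∀ i, |s i - c i| ≤ b i) :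
    ‖gatedSum x v s - gatedSum x v c‖ ≤ ‖v‖ * ∑ i, b i := by
  rw [gatedSum, gatedSum, ← Finset.sum_sub_distrib, Finset.mul_sum]
  refine norm_sum_le_of_le _ fun i _ => ?_
  rw [← smul_sub, ← sub_smul, norm_smul, norm_smul, Real.norm_eq_abs (s i - c i)]
  calc ‖v i‖ * (|s i - c i| * ‖x i‖) ≤ ‖v‖ * (b i * 1) := by
        gcongr
        · exact PiLp.norm_apply_le v i
        · exact (abs_nonneg _).trans (h i)
        · exact h i
        · exact hx i
    _ = _ := by rw [mul_one]

theorem norm_gatedSum_sq (x : ι → E) (v : EuclideanSpace ℝ ι) (c : ι → ℝ) :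
    ‖gatedSum x v c‖ ^ 2 = ∑ i, ∑ j, v i * v j * (⟪x i, x j⟫ * (c i * c j)) := by
  rw [← real_inner_self_eq_norm_sq, gatedSum, sum_inner]
  refine Finset.sum_congr rfl fun i _ => ?_
  rw [inner_sum]
  refine Finset.sum_congr rfl fun j _ => ?_
  simp only [real_inner_smul_left, real_inner_smul_right]
  ring

end GatedSum

variable {n m d : ℕ} {x : Fin n → EuclideanSpace ℝ (Fin d)} {y : EuclideanSpace ℝ (Fin n)}

/-! ### The gradient of the loss -/

theorem gradW_eq_smul_gatedSum (x : Fin n → EuclideanSpace ℝ (Fin d)) (y : EuclideanSpace ℝ (Fin n))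
    (W : Fin m → EuclideanSpace ℝ (Fin d)) (a : Fin m → ℝ) (c : Fin n → ℝ) (r : Fin m) :
    gradW x y W a c r = (1 / Real.sqrt m * a r) • gatedSum x (prediction x W a - y) c := by
  rw [gradW, gatedSum, mul_smul, Finset.smul_sum (r := a r)]
  refine congrArg _ (Finset.sum_congr rfl fun i _ => ?_)
  rw [smul_smul, smul_smul, prediction, PiLp.sub_apply]
  congr 1
  ring

theorem norm_gradW_sq (x : Fin n → EuclideanSpace ℝ (Fin d)) (y : EuclideanSpace ℝ (Fin n))
    (W : Fin m → EuclideanSpace ℝ (Fin d)) (a : Fin m → ℝ) (c : Fin n → ℝ) (r : Fin m) :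
    ‖gradW x y W a c r‖ ^ 2 =
      1 / m * (a r ^ 2 * ‖gatedSum x (prediction x W a - y) c‖ ^ 2) := by
  rw [gradW_eq_smul_gatedSum, norm_smul, mul_pow, Real.norm_eq_abs, sq_abs, mul_pow, div_pow,
    Real.sq_sqrt (Nat.cast_nonneg m), one_pow, mul_assoc]

theorem norm_gradW_le (hx : ∀ i, ‖x i‖ ≤ 1) (y : EuclideanSpace ℝ (Fin n))
    (W : Fin m → EuclideanSpace ℝ (Fin d)) {a : Fin m → ℝ} {c : Fin n → ℝ} {r : Fin m}
    (hc : ∀ i, |c i| ≤ 1) {A : ℝ} (hA : |a r| ≤ A) :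
    ‖gradW x y W a c r‖ ≤ Real.sqrt n * A / Real.sqrt m * ‖prediction x W a - y‖ := by
  have hA0 : 0 ≤ A := (abs_nonneg _).trans hA
  have hsum := norm_gatedSum_le hx (prediction x W a - y) hc
  rw [Fintype.card_fin] at hsum
  rw [gradW_eq_smul_gatedSum, norm_smul, norm_mul, Real.norm_of_nonneg (by positivity),
    Real.norm_eq_abs]
  calc _ ≤ 1 / Real.sqrt m * A * (Real.sqrt n * ‖prediction x W a - y‖) := by gcongr
    _ = _ := by ring

theorem abs_gradA_le (x : Fin n → EuclideanSpace ℝ (Fin d)) (y : EuclideanSpace ℝ (Fin n))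
    {W : Fin m → EuclideanSpace ℝ (Fin d)} (a : Fin m → ℝ) {r : Fin m} {M : ℝ}
    (hM : ∀ i, |⟪W r, x i⟫| ≤ M) :
    |gradA x y W a r| ≤ Real.sqrt n * M / Real.sqrt m * ‖prediction x W a - y‖ := by
  have hsum := norm_sum_smul_le (prediction x W a - y) (z := fun i => relu ⟪W r, x i⟫)
    fun i => (abs_relu_le _).trans (hM i)
  rw [Fintype.card_fin] at hsum
  rw [gradA, abs_mul, abs_of_nonneg (by positivity)]
  calc _ ≤ 1 / Real.sqrt m * (Real.sqrt n * ‖prediction x W a - y‖ * M) :=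
        mul_le_mul_of_nonneg_left hsum (by positivity)
    _ = _ := by ring

/-! ### The loss along a curve of parameters -/

theorem norm_prediction_sub_sq (x : Fin n → EuclideanSpace ℝ (Fin d)) (y : EuclideanSpace ℝ (Fin n))
    (W : Fin m → EuclideanSpace ℝ (Fin d)) (a : Fin m → ℝ) :
    ‖prediction x W a - y‖ ^ 2 = ∑ i, (net W a (x i) - y i) ^ 2 :=
  EuclideanSpace.real_norm_sq_eq _

section Curve

variable {W : ℝ → Fin m → EuclideanSpace ℝ (Fin d)} {a : ℝ → Fin m → ℝ} {t : ℝ}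
  {W' : Fin m → EuclideanSpace ℝ (Fin d)} {a' : Fin m → ℝ}

theorem hasDerivAt_net {z : EuclideanSpace ℝ (Fin d)} {c : Fin m → ℝ}
    (hW : ∀ r, HasDerivAt (fun s => W s r) (W' r) t)
    (ha : ∀ r, HasDerivAt (fun s => a s r) (a' r) t)
    (hd : ∀ r, DifferentiableAt ℝ (fun s => relu ⟪W s r, z⟫) t)
    (hc : ∀ r, c r ∈ reluSlope ⟪W t r, z⟫) :
    HasDerivAt (fun s => net (W s) (a s) z)
      (1 / Real.sqrt m * ∑ r, (a' r * relu ⟪W t r, z⟫ + a t r * (c r * ⟪W' r, z⟫))) t := by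
  refine HasDerivAt.const_mul _ (HasDerivAt.fun_sum fun r _ => ?_)
  have hinner : HasDerivAt (fun s => ⟪W s r, z⟫) ⟪W' r, z⟫ t := by
    simpa using (hW r).inner ℝ (hasDerivAt_const t z)
  exact (ha r).mul (hasDerivAt_relu_comp hinner (hd r) (hc r))

theorem hasDerivAt_loss {c : Fin m → Fin n → ℝ} (y : EuclideanSpace ℝ (Fin n))
    (hW : ∀ r, HasDerivAt (fun s => W s r) (W' r) t)
    (ha : ∀ r, HasDerivAt (fun s => a s r) (a' r) t)
    (hd : ∀ r i, DifferentiableAt ℝ (fun s => relu ⟪W s r, x i⟫) t)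
    (hc : ∀ r i, c r i ∈ reluSlope ⟪W t r, x i⟫) :
    HasDerivAt (fun s => ‖prediction x (W s) (a s) - y‖ ^ 2)
      (2 * ∑ r, (gradA x y (W t) (a t) r * a' r +
        ⟪gradW x y (W t) (a t) (c r) r, W' r⟫)) t := by
  simp only [norm_prediction_sub_sq]
  refine (HasDerivAt.fun_sum fun i _ => ((hasDerivAt_net hW ha (hd · i) (hc · i)).sub_const
    (y i)).fun_pow 2).congr_deriv ?_
  simp only [gradA, gradW, real_inner_smul_left, sum_inner, Finset.mul_sum, Finset.sum_mul,
    ← Finset.sum_add_distrib]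
  rw [Finset.sum_comm]
  refine Finset.sum_congr rfl fun r _ => Finset.sum_congr rfl fun i _ => ?_
  rw [real_inner_comm (W' r)]
  push_cast
  ring

end Curve

namespace IsGradientFlow

variable {W : ℝ → Fin m → EuclideanSpace ℝ (Fin d)} {a : ℝ → Fin m → ℝ} {T : ℝ}

theorem mono (h : IsGradientFlow x y T W a) {t : ℝ} (ht : t ∈ Set.Icc 0 T) :
    IsGradientFlow x y t W a := by
  have hsub : Set.Icc 0 t ⊆ Set.Icc 0 T := Set.Icc_subset_Icc_right ht.2
  have husub : Set.uIcc 0 t ⊆ Set.uIcc 0 T := by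
    rwa [Set.uIcc_of_le ht.1, Set.uIcc_of_le (ht.1.trans ht.2)]
  exact ⟨fun r => (h.absCont_W r).mono husub, fun r => (h.absCont_a r).mono husub,
    ae_restrict_of_ae_restrict_of_subset hsub h.deriv_W,
    ae_restrict_of_ae_restrict_of_subset hsub h.deriv_a⟩

theorem absCont_relu (h : IsGradientFlow x y T W a) (r : Fin m) (z : EuclideanSpace ℝ (Fin d)) :
    AbsolutelyContinuousOnInterval (fun t => relu ⟪W t r, z⟫) 0 T :=
  absolutelyContinuousOnInterval_comp_lipschitzWith lipschitzWith_relu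
    (absolutelyContinuousOnInterval_inner_const (h.absCont_W r) z)

theorem absCont_loss (h : IsGradientFlow x y T W a) :
    AbsolutelyContinuousOnInterval (fun t => ‖prediction x (W t) (a t) - y‖ ^ 2) 0 T := by
  simp only [norm_prediction_sub_sq]
  have hres : ∀ i, AbsolutelyContinuousOnInterval (fun t => net (W t) (a t) (x i) - y i) 0 T :=
    fun i => .fun_sub (.const_mul _ (absolutelyContinuousOnInterval_sum _ fun r _ =>
      (h.absCont_a r).fun_mul (h.absCont_relu r (x i))))
    (absolutelyContinuousOnInterval_const _ _ _)
  refine absolutelyContinuousOnInterval_sum _ fun i _ => ?_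
  simpa only [pow_two] using (hres i).fun_mul (hres i)

theorem ae_hasDerivAt_loss (h : IsGradientFlow x y T W a) (hT : 0 ≤ T) :
    ∀ᵐ t ∂volume.restrict (Set.Ico 0 T), ∃ c : Fin m → Fin n → ℝ,
      (∀ r i, c r i ∈ reluSlope ⟪W t r, x i⟫) ∧
      HasDerivAt (fun s => ‖prediction x (W s) (a s) - y‖ ^ 2)
        (-2 * ∑ r, (gradA x y (W t) (a t) r ^ 2 + ‖gradW x y (W t) (a t) (c r) r‖ ^ 2)) t := by
  have hdiff : ∀ᵐ t ∂volume.restrict (Set.Ico 0 T),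
      ∀ r i, DifferentiableAt ℝ (fun s => relu ⟪W s r, x i⟫) t :=
    ae_all_iff.2 fun r => ae_all_iff.2 fun i =>
      ae_restrict_Ico_differentiableAt hT (h.absCont_relu r (x i))
  filter_upwards [ae_restrict_of_ae_restrict_of_subset Set.Ico_subset_Icc_self h.deriv_W,
    ae_restrict_of_ae_restrict_of_subset Set.Ico_subset_Icc_self h.deriv_a, hdiff]
    with t ⟨c, hc, hW⟩ ha hd
  refine ⟨c, hc, (hasDerivAt_loss y hW ha hd hc).congr_deriv ?_⟩
  simp only [inner_neg_right, real_inner_self_eq_norm_sq, mul_neg, ← pow_two, ← neg_add,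
    Finset.sum_neg_distrib, neg_mul]

end IsGradientFlow

/-! ### The Gram matrix and its smallest eigenvalue -/

section SmallestEigenvalue

variable {A B : Matrix (Fin n) (Fin n) ℝ} {ε : ℝ}

theorem lambdaMin_mul_norm_sq_le (hA : A.IsHermitian) (v : EuclideanSpace ℝ (Fin n)) :
    lambdaMin A * ‖v‖ ^ 2 ≤ v.ofLp ⬝ᵥ A.mulVec v.ofLp := by
  have hpsd : (A - algebraMap ℝ (Matrix (Fin n) (Fin n) ℝ) (lambdaMin A)).PosSemidef := by
    rw [Matrix.posSemidef_iff_isHermitian_and_spectrum_nonneg]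
    refine ⟨hA.sub ?_, ?_⟩
    · rw [Matrix.algebraMap_eq_diagonal]
      exact Matrix.isHermitian_diagonal _
    · rw [← spectrum.sub_singleton_eq]
      rintro _ ⟨b, hb, c, rfl, rfl⟩
      exact sub_nonneg.2 (csInf_le Matrix.finite_real_spectrum.bddBelow hb)
  have h := hpsd.dotProduct_mulVec_nonneg v.ofLp
  rw [Matrix.sub_mulVec, Algebra.algebraMap_eq_smul_one, Matrix.smul_mulVec, Matrix.one_mulVec,
    dotProduct_sub, dotProduct_smul, sub_nonneg, star_trivial, smul_eq_mul] at h
  have hnorm : ‖v‖ ^ 2 = v.ofLp ⬝ᵥ v.ofLp := by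
    rw [EuclideanSpace.real_norm_sq_eq, dotProduct]
    exact Finset.sum_congr rfl fun i _ => pow_two _
  rwa [hnorm]

theorem lambdaMin_le_apply_self (hA : A.IsHermitian) (i : Fin n) : lambdaMin A ≤ A i i := by
  simpa using lambdaMin_mul_norm_sq_le hA (EuclideanSpace.single i (1 : ℝ))

theorem abs_dotProduct_mulVec_le {ι : Type*} [Fintype ι] {A : Matrix ι ι ℝ}
    (h : ∀ i j, |A i j| ≤ ε) (v : EuclideanSpace ℝ ι) :
    |v.ofLp ⬝ᵥ A.mulVec v.ofLp| ≤ Fintype.card ι * ε * ‖v‖ ^ 2 := by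
  have hrow : ∀ i, ‖A.mulVec v.ofLp i‖ ≤ Real.sqrt (Fintype.card ι) * ‖v‖ * ε := fun i => by
    rw [Matrix.mulVec, dotProduct_comm]
    exact norm_sum_smul_le v (h i)
  calc |v.ofLp ⬝ᵥ A.mulVec v.ofLp|
      ≤ Real.sqrt (Fintype.card ι) * ‖v‖ * (Real.sqrt (Fintype.card ι) * ‖v‖ * ε) :=
        norm_sum_smul_le v hrow
    _ = Real.sqrt (Fintype.card ι) ^ 2 * ε * ‖v‖ ^ 2 := by ring
    _ = _ := by rw [Real.sq_sqrt (Nat.cast_nonneg _)]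

theorem lambdaMin_sub_mul_norm_sq_le (hA : A.IsHermitian) (h : ∀ i j, |B i j - A i j| ≤ ε)
    (v : EuclideanSpace ℝ (Fin n)) :
    (lambdaMin A - n * ε) * ‖v‖ ^ 2 ≤ v.ofLp ⬝ᵥ B.mulVec v.ofLp := by
  have hdiff := neg_le_of_abs_le (abs_dotProduct_mulVec_le (A := B - A) h v)
  rw [Matrix.sub_mulVec, dotProduct_sub, Fintype.card_fin] at hdiff
  linarith [lambdaMin_mul_norm_sq_le hA v]

end SmallestEigenvalue

/-- The Gram matrix of a single neuron with weight `w`; its expectation over `w ∼ N(0, I)` is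
`gramInf x`. -/
noncomputable def neuronGram (x : Fin n → EuclideanSpace ℝ (Fin d)) (w : EuclideanSpace ℝ (Fin d)) :
    Matrix (Fin n) (Fin n) ℝ :=
  Matrix.of fun i j => ⟪x i, x j⟫ * (step ⟪w, x i⟫ * step ⟪w, x j⟫)

theorem dotProduct_neuronGram_mulVec (x : Fin n → EuclideanSpace ℝ (Fin d))
    (w : EuclideanSpace ℝ (Fin d)) (v : EuclideanSpace ℝ (Fin n)) :
    v.ofLp ⬝ᵥ (neuronGram x w).mulVec v.ofLp = ‖gatedSum x v fun i => step ⟪w, x i⟫‖ ^ 2 := by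
  simp only [norm_gatedSum_sq, dotProduct, Matrix.mulVec, neuronGram, Matrix.of_apply,
    Finset.mul_sum]
  exact Finset.sum_congr rfl fun i _ => Finset.sum_congr rfl fun j _ => by ring

/-- The empirical Gram matrix `H(0)` of the first layer. -/
noncomputable def gramInit (x : Fin n → EuclideanSpace ℝ (Fin d))
    (W : Fin m → EuclideanSpace ℝ (Fin d)) : Matrix (Fin n) (Fin n) ℝ :=
  (1 / m : ℝ) • ∑ r, neuronGram x (W r)

theorem gramInit_apply (x : Fin n → EuclideanSpace ℝ (Fin d))
    (W : Fin m → EuclideanSpace ℝ (Fin d)) (i j : Fin n) :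
    gramInit x W i j = 1 / m * ∑ r, neuronGram x (W r) i j := by
  rw [gramInit, Matrix.smul_apply, Matrix.sum_apply, smul_eq_mul]

theorem dotProduct_gramInit_mulVec (x : Fin n → EuclideanSpace ℝ (Fin d))
    (W : Fin m → EuclideanSpace ℝ (Fin d)) (v : EuclideanSpace ℝ (Fin n)) :
    v.ofLp ⬝ᵥ (gramInit x W).mulVec v.ofLp =
      1 / m * ∑ r, ‖gatedSum x v fun i => step ⟪W r, x i⟫‖ ^ 2 := by
  simp only [gramInit, Matrix.smul_mulVec, Matrix.sum_mulVec, dotProduct_smul, dotProduct_sum,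
    dotProduct_neuronGram_mulVec, smul_eq_mul]

@[fun_prop]
theorem measurable_neuronGram (x : Fin n → EuclideanSpace ℝ (Fin d)) (i j : Fin n) :
    Measurable fun w => neuronGram x w i j := by
  simp only [neuronGram, Matrix.of_apply]
  fun_prop

theorem abs_neuronGram_le_one (hx : ∀ i, ‖x i‖ ≤ 1) (w : EuclideanSpace ℝ (Fin d)) (i j : Fin n) :
    |neuronGram x w i j| ≤ 1 := by
  have hinner : |⟪x i, x j⟫| ≤ 1 :=
    (abs_real_inner_le_norm _ _).trans (mul_le_one₀ (hx i) (norm_nonneg _) (hx j))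
  rw [neuronGram, Matrix.of_apply, abs_mul, abs_mul]
  exact mul_le_one₀ hinner (by positivity)
    (mul_le_one₀ (abs_step_le_one _) (abs_nonneg _) (abs_step_le_one _))

theorem gramInf_apply (x : Fin n → EuclideanSpace ℝ (Fin d)) (i j : Fin n) :
    gramInf x i j = ∫ w, neuronGram x w i j ∂(stdGaussian (EuclideanSpace ℝ (Fin d))) := by
  rw [gramInf, Matrix.of_apply]
  refine integral_congr_ae (Filter.Eventually.of_forall fun w => ?_)
  by_cases h1 : 0 ≤ ⟪w, x i⟫ <;> by_cases h2 : 0 ≤ ⟪w, x j⟫ <;> simp [neuronGram, step, h1, h2]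

theorem isHermitian_gramInf (x : Fin n → EuclideanSpace ℝ (Fin d)) : (gramInf x).IsHermitian := by
  ext i j
  rw [Matrix.conjTranspose_apply, star_trivial, gramInf_apply, gramInf_apply]
  simp only [neuronGram, Matrix.of_apply, real_inner_comm (x i) (x j), mul_comm (step ⟪_, x i⟫)]

theorem lambdaMin_gramInf_le_one (hx : ∀ i, ‖x i‖ ≤ 1) (hn : 0 < n) :
    lambdaMin (gramInf x) ≤ 1 := by
  refine (lambdaMin_le_apply_self (isHermitian_gramInf x) ⟨0, hn⟩).trans ?_
  rw [gramInf_apply]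
  have h := norm_integral_le_of_norm_le_const (μ := stdGaussian (EuclideanSpace ℝ (Fin d)))
    (f := fun w => neuronGram x w ⟨0, hn⟩ ⟨0, hn⟩) (C := 1)
    (Filter.Eventually.of_forall fun w => abs_neuronGram_le_one hx w _ _)
  rw [probReal_univ, mul_one] at h
  exact (le_abs_self _).trans h

/-! ### Good initializations -/

/-- The five events on the initialization under which every gradient flow converges: signs of
modulus one, a Gram matrix close to its expectation, few preactivations within `R` of the kink,
preactivations bounded by `M`, and predictions of squared norm below `S`. -/
structure IsGoodInit (x : Fin n → EuclideanSpace ℝ (Fin d)) (R M S : ℝ)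
    (W₀ : Fin m → EuclideanSpace ℝ (Fin d)) (a₀ : Fin m → ℝ) : Prop where
  sign : ∀ r, |a₀ r| = 1
  gram : ∀ i j, |gramInit x W₀ i j - gramInf x i j| < lambdaMin (gramInf x) / (8 * n)
  margin : ∑ r, ∑ i, nearZero R ⟪W₀ r, x i⟫ < m * lambdaMin (gramInf x) / (16 * n)
  bound : ∀ r i, |⟪W₀ r, x i⟫| < M
  output : ∑ i, net W₀ a₀ (x i) ^ 2 < S

/-- The region around the initialization in which the Gram matrix stays well conditioned. -/
def NearInit (R : ℝ) (W₀ W : Fin m → EuclideanSpace ℝ (Fin d)) (a₀ a : Fin m → ℝ) : Prop :=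
  ∀ r, ‖W r - W₀ r‖ < R ∧ |a r - a₀ r| < 1 / 8

theorem norm_gatedSum_step_sq_sub_le (hx : ∀ i, ‖x i‖ ≤ 1) (v : EuclideanSpace ℝ (Fin n))
    {w₀ w : EuclideanSpace ℝ (Fin d)} {R : ℝ} (hw : ‖w - w₀‖ ≤ R) {c : Fin n → ℝ}
    (hc : ∀ i, c i ∈ reluSlope ⟪w, x i⟫) :
    ‖gatedSum x v fun i => step ⟪w₀, x i⟫‖ ^ 2 -
      2 * Real.sqrt n * ‖v‖ ^ 2 * ∑ i, nearZero R ⟪w₀, x i⟫ ≤ ‖gatedSum x v c‖ ^ 2 := by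
  have hmove : ∀ i, |⟪w, x i⟫ - ⟪w₀, x i⟫| ≤ R := fun i => by
    rw [← inner_sub_left]
    exact (abs_real_inner_le_norm _ _).trans
      ((mul_le_of_le_one_right (norm_nonneg _) (hx i)).trans hw)
  have hdiff := norm_gatedSum_sub_le hx v fun i => abs_step_sub_slope_le (hc i) (hmove i)
  have hstep := norm_gatedSum_le hx v (c := fun i => step ⟪w₀, x i⟫) fun i => abs_step_le_one _
  have hslope := norm_gatedSum_le hx v fun i => abs_le_one_of_mem_reluSlope (hc i)
  rw [Fintype.card_fin] at hstep hslope
  set p := ‖gatedSum x v c‖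
  set q := ‖gatedSum x v fun i => step ⟪w₀, x i⟫‖
  have hsub : q - p ≤ ‖v‖ * ∑ i, nearZero R ⟪w₀, x i⟫ := (norm_sub_norm_le _ _).trans hdiff
  have hcount : 0 ≤ ∑ i, nearZero R ⟪w₀, x i⟫ :=
    Finset.sum_nonneg fun i _ => nearZero_nonneg _ _
  have hfactor : (q - p) * (q + p) ≤
      (‖v‖ * ∑ i, nearZero R ⟪w₀, x i⟫) * (2 * (Real.sqrt n * ‖v‖)) := by
    gcongr
    linarith
  linarith

namespace IsGoodInit

variable {R M S : ℝ} {W₀ W : Fin m → EuclideanSpace ℝ (Fin d)} {a₀ a : Fin m → ℝ}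

theorem gatedSum_lower_bound (h : IsGoodInit x R M S W₀ a₀) (hn : 0 < n) (hm : 0 < m)
    (hx : ∀ i, ‖x i‖ ≤ 1) (hW : ∀ r, ‖W r - W₀ r‖ ≤ R) {c : Fin m → Fin n → ℝ}
    (hc : ∀ r i, c r i ∈ reluSlope ⟪W r, x i⟫) (v : EuclideanSpace ℝ (Fin n)) :
    3 / 4 * lambdaMin (gramInf x) * ‖v‖ ^ 2 ≤ 1 / m * ∑ r, ‖gatedSum x v (c r)‖ ^ 2 := by
  have hn' : (1 : ℝ) ≤ n := by exact_mod_cast hn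
  have hm' : (0 : ℝ) < m := by exact_mod_cast hm
  have hsqrt : Real.sqrt n ≤ n := (Real.sqrt_le_left (by positivity)).2 (by nlinarith)
  set lam := lambdaMin (gramInf x)
  have hcount : 0 ≤ ∑ r, ∑ i, nearZero R ⟪W₀ r, x i⟫ :=
    Finset.sum_nonneg fun r _ => Finset.sum_nonneg fun i _ => nearZero_nonneg _ _
  have hinit : 7 / 8 * lam * ‖v‖ ^ 2 ≤
      1 / m * ∑ r, ‖gatedSum x v fun i => step ⟪W₀ r, x i⟫‖ ^ 2 := by
    rw [← dotProduct_gramInit_mulVec]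
    convert lambdaMin_sub_mul_norm_sq_le (isHermitian_gramInf x) (fun i j => (h.gram i j).le) v
      using 2
    field_simp
    ring
  have hflip : 2 * Real.sqrt n * ‖v‖ ^ 2 * ∑ r, ∑ i, nearZero R ⟪W₀ r, x i⟫ ≤
      m * (1 / 8 * lam * ‖v‖ ^ 2) := by
    calc _ ≤ 2 * n * ‖v‖ ^ 2 * (m * lam / (16 * n)) := by gcongr; exact h.margin.le
      _ = _ := by field_simp; ring
  have hsum : ∑ r, ‖gatedSum x v fun i => step ⟪W₀ r, x i⟫‖ ^ 2 -
      2 * Real.sqrt n * ‖v‖ ^ 2 * ∑ r, ∑ i, nearZero R ⟪W₀ r, x i⟫ ≤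
      ∑ r, ‖gatedSum x v (c r)‖ ^ 2 := by
    rw [Finset.mul_sum, ← Finset.sum_sub_distrib]
    exact Finset.sum_le_sum fun r _ => norm_gatedSum_step_sq_sub_le hx v (hW r) (hc r)
  rw [one_div, inv_mul_eq_div, le_div_iff₀ hm'] at hinit ⊢
  linarith

theorem abs_lt_two (h : IsGoodInit x R M S W₀ a₀) (hnear : NearInit R W₀ W a₀ a) (r : Fin m) :
    |a r| < 2 := by
  have := abs_sub_abs_le_abs_sub (a r) (a₀ r)
  linarith [(hnear r).2, h.sign r]

theorem le_sq_of_nearInit (h : IsGoodInit x R M S W₀ a₀) (hnear : NearInit R W₀ W a₀ a)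
    (r : Fin m) : 49 / 64 ≤ a r ^ 2 := by
  have hsub := abs_sub_abs_le_abs_sub (a₀ r) (a r)
  rw [abs_sub_comm] at hsub
  have habs : 7 / 8 ≤ |a r| := by linarith [(hnear r).2, h.sign r]
  rw [← sq_abs]
  nlinarith

theorem abs_inner_le (h : IsGoodInit x R M S W₀ a₀) (hx : ∀ i, ‖x i‖ ≤ 1)
    (hnear : NearInit R W₀ W a₀ a) (r : Fin m) (i : Fin n) : |⟪W r, x i⟫| ≤ M + R := by
  have hmove : |⟪W r - W₀ r, x i⟫| ≤ R :=
    (abs_real_inner_le_norm _ _).trans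
      ((mul_le_of_le_one_right (norm_nonneg _) (hx i)).trans (hnear r).1.le)
  rw [← add_sub_cancel (W₀ r) (W r), inner_add_left]
  exact (abs_add_le _ _).trans (add_le_add (h.bound r i).le hmove)

theorem half_lambdaMin_mul_loss_le (h : IsGoodInit x R M S W₀ a₀) (hn : 0 < n) (hm : 0 < m)
    (hlam : 0 < lambdaMin (gramInf x)) (hx : ∀ i, ‖x i‖ ≤ 1) (hnear : NearInit R W₀ W a₀ a)
    {c : Fin m → Fin n → ℝ} (hc : ∀ r i, c r i ∈ reluSlope ⟪W r, x i⟫)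
    (y : EuclideanSpace ℝ (Fin n)) :
    lambdaMin (gramInf x) / 2 * ‖prediction x W a - y‖ ^ 2 ≤ ∑ r, ‖gradW x y W a (c r) r‖ ^ 2 := by
  set v := prediction x W a - y
  have hgram := h.gatedSum_lower_bound hn hm hx (fun r => (hnear r).1.le) hc v
  calc lambdaMin (gramInf x) / 2 * ‖v‖ ^ 2
      ≤ 49 / 64 * (3 / 4 * lambdaMin (gramInf x) * ‖v‖ ^ 2) := by
        linarith [mul_nonneg hlam.le (sq_nonneg ‖v‖)]
    _ ≤ 49 / 64 * (1 / m * ∑ r, ‖gatedSum x v (c r)‖ ^ 2) := by gcongr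
    _ = ∑ r, 1 / m * (49 / 64 * ‖gatedSum x v (c r)‖ ^ 2) := by
        simp only [Finset.mul_sum]
        exact Finset.sum_congr rfl fun r _ => by ring
    _ ≤ ∑ r, ‖gradW x y W a (c r) r‖ ^ 2 := by
        simp only [norm_gradW_sq]
        gcongr with r
        exact h.le_sq_of_nearInit hnear r

end IsGoodInit

/-! ### The flow started from a good initialization -/

section Flow

variable {R M S T L : ℝ} {W : ℝ → Fin m → EuclideanSpace ℝ (Fin d)} {a : ℝ → Fin m → ℝ}

theorem IsGradientFlow.norm_weight_sub_le (hflow : IsGradientFlow x y T W a) (hT : 0 ≤ T)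
    (hx : ∀ i, ‖x i‖ ≤ 1) {r : Fin m} {A μ : ℝ} (hA : 0 ≤ A) (hμ : 0 < μ)
    (ha : ∀ s ∈ Set.Ico 0 T, |a s r| ≤ A)
    (hres : ∀ s ∈ Set.Ico 0 T, ‖prediction x (W s) (a s) - y‖ ≤
      ‖prediction x (W 0) (a 0) - y‖ * Real.exp (-μ * s)) :
    ‖W T r - W 0 r‖ ≤ Real.sqrt n * A / Real.sqrt m * ‖prediction x (W 0) (a 0) - y‖ / μ := by
  refine norm_sub_le_of_ae_norm_deriv_le_exp hT (by positivity) hμ (hflow.absCont_W r) ?_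
  filter_upwards [ae_restrict_mem measurableSet_Ico,
    ae_restrict_of_ae_restrict_of_subset Set.Ico_subset_Icc_self hflow.deriv_W]
    with s hs ⟨c, hc, hW⟩
  refine ⟨_, hW r, ?_⟩
  rw [norm_neg, mul_assoc]
  exact (norm_gradW_le hx y (W s) (fun i => abs_le_one_of_mem_reluSlope (hc r i)) (ha s hs)).trans
    (mul_le_mul_of_nonneg_left (hres s hs) (by positivity))

theorem IsGradientFlow.abs_sign_sub_le (hflow : IsGradientFlow x y T W a) (hT : 0 ≤ T) {r : Fin m}
    {B μ : ℝ} (hB : 0 ≤ B) (hμ : 0 < μ) (hW : ∀ s ∈ Set.Ico 0 T, ∀ i, |⟪W s r, x i⟫| ≤ B)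
    (hres : ∀ s ∈ Set.Ico 0 T, ‖prediction x (W s) (a s) - y‖ ≤
      ‖prediction x (W 0) (a 0) - y‖ * Real.exp (-μ * s)) :
    |a T r - a 0 r| ≤ Real.sqrt n * B / Real.sqrt m * ‖prediction x (W 0) (a 0) - y‖ / μ := by
  refine norm_sub_le_of_ae_norm_deriv_le_exp hT (by positivity) hμ (hflow.absCont_a r) ?_
  filter_upwards [ae_restrict_mem measurableSet_Ico,
    ae_restrict_of_ae_restrict_of_subset Set.Ico_subset_Icc_self hflow.deriv_a] with s hs ha
  refine ⟨_, ha r, ?_⟩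
  rw [norm_neg, mul_assoc]
  exact (abs_gradA_le x y (a s) (hW s hs)).trans
    (mul_le_mul_of_nonneg_left (hres s hs) (by positivity))

/-- The three bounds of the theorem at time `t`, with `L` for the logarithmic factor. -/
def FlowBounds (x : Fin n → EuclideanSpace ℝ (Fin d)) (y : EuclideanSpace ℝ (Fin n)) (L : ℝ)
    (W : ℝ → Fin m → EuclideanSpace ℝ (Fin d)) (a : ℝ → Fin m → ℝ) (t : ℝ) : Prop :=
  ‖prediction x (W t) (a t) - y‖ ^ 2 ≤
    Real.exp (-lambdaMin (gramInf x) * t) * ‖prediction x (W 0) (a 0) - y‖ ^ 2 ∧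
  (∀ r, ‖W t r - W 0 r‖ ≤ 4 * Real.sqrt n * ‖y - prediction x (W 0) (a 0)‖ /
    (Real.sqrt m * lambdaMin (gramInf x))) ∧
  (∀ r, |a t r - a 0 r| ≤ 8 * Real.sqrt n * ‖y - prediction x (W 0) (a 0)‖ * L /
    (Real.sqrt m * lambdaMin (gramInf x)))

namespace IsGoodInit

theorem loss_le_exp_mul_of_nearInit (h : IsGoodInit x R M S (W 0) (a 0)) (hn : 0 < n) (hm : 0 < m)
    (hlam : 0 < lambdaMin (gramInf x)) (hx : ∀ i, ‖x i‖ ≤ 1) (hflow : IsGradientFlow x y T W a)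
    (hT : 0 ≤ T) (hnear : ∀ s ∈ Set.Ico 0 T, NearInit R (W 0) (W s) (a 0) (a s)) :
    ‖prediction x (W T) (a T) - y‖ ^ 2 ≤
      Real.exp (-lambdaMin (gramInf x) * T) * ‖prediction x (W 0) (a 0) - y‖ ^ 2 := by
  refine le_exp_mul_of_ae_deriv_le hT hflow.absCont_loss ?_
  filter_upwards [ae_restrict_mem measurableSet_Ico, hflow.ae_hasDerivAt_loss hT]
    with s hs ⟨c, hc, hderiv⟩
  rw [hderiv.deriv, Finset.sum_add_distrib]
  have hPL := h.half_lambdaMin_mul_loss_le hn hm hlam hx (hnear s hs) hc y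
  have hA : 0 ≤ ∑ r, gradA x y (W s) (a s) r ^ 2 := Finset.sum_nonneg fun r _ => sq_nonneg _
  linarith

theorem norm_residual_le_of_nearInit (h : IsGoodInit x R M S (W 0) (a 0)) (hn : 0 < n) (hm : 0 < m)
    (hlam : 0 < lambdaMin (gramInf x)) (hx : ∀ i, ‖x i‖ ≤ 1) (hflow : IsGradientFlow x y T W a)
    (hnear : ∀ s ∈ Set.Ico 0 T, NearInit R (W 0) (W s) (a 0) (a s)) {t : ℝ}
    (ht : t ∈ Set.Icc 0 T) :
    ‖prediction x (W t) (a t) - y‖ ≤ ‖prediction x (W 0) (a 0) - y‖ *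
      Real.exp (-(lambdaMin (gramInf x) / 2) * t) := by
  have hloss := h.loss_le_exp_mul_of_nearInit hn hm hlam hx (hflow.mono ht) ht.1
    fun s hs => hnear s ⟨hs.1, hs.2.trans_le ht.2⟩
  have hexp : Real.exp (-(lambdaMin (gramInf x) / 2) * t) ^ 2 =
      Real.exp (-lambdaMin (gramInf x) * t) := by
    rw [← Real.exp_nat_mul]
    congr 1
    push_cast
    ring
  refine (pow_le_pow_iff_left₀ (norm_nonneg _) (by positivity) two_ne_zero).1 ?_
  rwa [mul_pow, hexp, mul_comm]

theorem flowBounds_of_nearInit (h : IsGoodInit x R M S (W 0) (a 0)) (hn : 0 < n) (hm : 0 < m)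
    (hlam : 0 < lambdaMin (gramInf x)) (hx : ∀ i, ‖x i‖ ≤ 1) (hML : M + R ≤ 4 * L) (hL : 0 ≤ L)
    (hflow : IsGradientFlow x y T W a) (hT : 0 ≤ T)
    (hnear : ∀ s ∈ Set.Ico 0 T, NearInit R (W 0) (W s) (a 0) (a s)) :
    FlowBounds x y L W a T := by
  have hres : ∀ s ∈ Set.Ico 0 T, ‖prediction x (W s) (a s) - y‖ ≤ _ := fun s hs =>
    h.norm_residual_le_of_nearInit hn hm hlam hx hflow hnear ⟨hs.1, hs.2.le⟩
  refine ⟨h.loss_le_exp_mul_of_nearInit hn hm hlam hx hflow hT hnear, fun r => ?_, fun r => ?_⟩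
  · refine (hflow.norm_weight_sub_le hT hx zero_le_two (half_pos hlam)
      (fun s hs => (h.abs_lt_two (hnear s hs) r).le) hres).trans (le_of_eq ?_)
    rw [norm_sub_rev y]
    ring
  · refine (hflow.abs_sign_sub_le hT (B := 4 * L) (by positivity) (half_pos hlam)
      (fun s hs i => (h.abs_inner_le hx (hnear s hs) r i).trans hML) hres).trans (le_of_eq ?_)
    rw [norm_sub_rev y]
    ring

theorem nearInit_of_isGradientFlow (h : IsGoodInit x R M S (W 0) (a 0)) (hn : 0 < n) (hm : 0 < m)
    (hlam : 0 < lambdaMin (gramInf x)) (hx : ∀ i, ‖x i‖ ≤ 1) (hML : M + R ≤ 4 * L) (hL : 0 ≤ L)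
    (hWlt : 4 * Real.sqrt n * ‖y - prediction x (W 0) (a 0)‖ /
      (Real.sqrt m * lambdaMin (gramInf x)) < R)
    (halt : 8 * Real.sqrt n * ‖y - prediction x (W 0) (a 0)‖ * L /
      (Real.sqrt m * lambdaMin (gramInf x)) < 1 / 8)
    (hflow : IsGradientFlow x y T W a) :
    ∀ t ∈ Set.Icc 0 T, NearInit R (W 0) (W t) (a 0) (a t) := by
  rcases lt_or_ge T 0 with hT | hT
  · simp [Set.Icc_eq_empty hT.not_ge]
  have hcontW := fun r => Set.uIcc_of_le hT ▸ (hflow.absCont_W r).continuousOn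
  have hconta := fun r => Set.uIcc_of_le hT ▸ (hflow.absCont_a r).continuousOn
  refine forall_mem_Icc_of_forall_Ico_imp ?_ fun t ht hnear r => ?_
  · have hfar : {t | t ∈ Set.Icc 0 T ∧ ¬ NearInit R (W 0) (W t) (a 0) (a t)} =
        ⋃ r, ((Set.Icc 0 T ∩ (fun t => ‖W t r - W 0 r‖) ⁻¹' Set.Ici R) ∪
          (Set.Icc 0 T ∩ (fun t => |a t r - a 0 r|) ⁻¹' Set.Ici (1 / 8))) := by
      ext t
      simp only [NearInit, Set.mem_ofPred_eq, Set.mem_iUnion, Set.mem_union, Set.mem_inter_iff,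
        Set.mem_preimage, Set.mem_Ici, not_forall, not_and_or, not_lt, ← and_or_left,
        exists_and_left]
    rw [hfar]
    exact isClosed_iUnion_of_finite fun r =>
      (((hcontW r).sub continuousOn_const).norm.preimage_isClosed_of_isClosed isClosed_Icc
        isClosed_Ici).union (((hconta r).sub continuousOn_const).abs.preimage_isClosed_of_isClosed
          isClosed_Icc isClosed_Ici)
  · have hb := h.flowBounds_of_nearInit hn hm hlam hx hML hL (hflow.mono ht) ht.1 hnear
    exact ⟨(hb.2.1 r).trans_lt hWlt, (hb.2.2 r).trans_lt halt⟩

theorem flowBounds (h : IsGoodInit x R M S (W 0) (a 0)) (hn : 0 < n) (hm : 0 < m)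
    (hlam : 0 < lambdaMin (gramInf x)) (hx : ∀ i, ‖x i‖ ≤ 1) (hML : M + R ≤ 4 * L) (hL : 0 ≤ L)
    (hWlt : 4 * Real.sqrt n * ‖y - prediction x (W 0) (a 0)‖ /
      (Real.sqrt m * lambdaMin (gramInf x)) < R)
    (halt : 8 * Real.sqrt n * ‖y - prediction x (W 0) (a 0)‖ * L /
      (Real.sqrt m * lambdaMin (gramInf x)) < 1 / 8)
    (hflow : IsGradientFlow x y T W a) {t : ℝ} (ht : t ∈ Set.Icc 0 T) :
    FlowBounds x y L W a t :=
  h.flowBounds_of_nearInit hn hm hlam hx hML hL (hflow.mono ht) ht.1 fun s hs =>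
    h.nearInit_of_isGradientFlow hn hm hlam hx hML hL hWlt halt hflow s
      ⟨hs.1, hs.2.le.trans ht.2⟩

end IsGoodInit

end Flow

/-! ### Gaussian and Rademacher variables -/

theorem measurePreserving_inner_stdGaussian {E : Type*} [NormedAddCommGroup E]
    [InnerProductSpace ℝ E] [FiniteDimensional ℝ E] [MeasurableSpace E] [BorelSpace E] {x : E}
    (hx : ‖x‖ = 1) :
    MeasurePreserving (fun w => ⟪w, x⟫) (stdGaussian E) (gaussianReal 0 1) := by
  refine ⟨by fun_prop, ?_⟩
  have h := IsGaussian.map_eq_gaussianReal (μ := stdGaussian E) (innerSL ℝ x)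
  rw [integral_strongDual_stdGaussian, variance_dual_stdGaussian, innerSL_apply_norm, hx, one_pow,
    Real.toNNReal_one] at h
  rw [← h]
  exact congrArg (Measure.map · _) (funext fun w => real_inner_comm x w)

theorem gaussianPDFReal_le (μ : ℝ) (v : NNReal) (z : ℝ) :
    gaussianPDFReal μ v z ≤ (Real.sqrt (2 * Real.pi * v))⁻¹ := by
  rw [gaussianPDFReal]
  refine mul_le_of_le_one_right (by positivity) (Real.exp_le_one_iff.2 ?_)
  exact div_nonpos_of_nonpos_of_nonneg (neg_nonpos.2 (sq_nonneg _)) (by positivity)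

theorem gaussianReal_real_Icc_le (μ : ℝ) {v : NNReal} (hv : v ≠ 0) {a b : ℝ} (hab : a ≤ b) :
    (gaussianReal μ v).real (Set.Icc a b) ≤ (Real.sqrt (2 * Real.pi * v))⁻¹ * (b - a) := by
  rw [measureReal_def, gaussianReal_apply μ hv]
  refine ENNReal.toReal_le_of_le_ofReal (mul_nonneg (by positivity) (sub_nonneg.2 hab)) ?_
  calc ∫⁻ z in Set.Icc a b, gaussianPDF μ v z
      ≤ ∫⁻ _ in Set.Icc a b, ENNReal.ofReal (Real.sqrt (2 * Real.pi * v))⁻¹ :=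
        lintegral_mono fun z => ENNReal.ofReal_le_ofReal (gaussianPDFReal_le μ v z)
    _ = ENNReal.ofReal ((Real.sqrt (2 * Real.pi * v))⁻¹ * (b - a)) := by
        rw [setLIntegral_const, Real.volume_Icc, ENNReal.ofReal_mul (by positivity)]

theorem gaussianReal_real_abs_le_le {R : ℝ} (hR : 0 ≤ R) :
    (gaussianReal 0 1).real {z | |z| ≤ R} ≤ R := by
  have hset : {z : ℝ | |z| ≤ R} = Set.Icc (-R) R := by
    ext z
    simp only [Set.mem_ofPred_eq, Set.mem_Icc, abs_le]
  have hsqrt : 2 ≤ Real.sqrt (2 * Real.pi * (1 : NNReal)) := by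
    refine Real.le_sqrt_of_sq_le ?_
    rw [NNReal.coe_one]
    linarith [Real.pi_gt_three]
  calc (gaussianReal 0 1).real {z | |z| ≤ R}
      ≤ (Real.sqrt (2 * Real.pi * (1 : NNReal)))⁻¹ * (R - -R) :=
        hset ▸ gaussianReal_real_Icc_le 0 one_ne_zero (by linarith)
    _ ≤ 2⁻¹ * (R - -R) := by gcongr; linarith
    _ = R := by ring

theorem measureReal_le_abs_le_of_hasSubgaussianMGF {Ω : Type*} [MeasurableSpace Ω] {μ : Measure Ω}
    {X : Ω → ℝ} {c : NNReal} (h : HasSubgaussianMGF X c μ) {ε : ℝ} (hε : 0 ≤ ε) :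
    μ.real {ω | ε ≤ |X ω|} ≤ 2 * Real.exp (-ε ^ 2 / (2 * c)) := by
  have hset : {ω | ε ≤ |X ω|} = {ω | ε ≤ X ω} ∪ {ω | ε ≤ (-X) ω} := by
    ext ω
    simp only [Set.mem_union, Set.mem_ofPred_eq, Pi.neg_apply, le_abs]
  rw [hset, two_mul]
  exact (measureReal_union_le _ _).trans (add_le_add (h.measure_ge_le hε) (h.neg.measure_ge_le hε))

theorem hasSubgaussianMGF_id_gaussianReal (v : NNReal) :
    HasSubgaussianMGF id v (gaussianReal 0 v) where
  integrable_exp_mul := integrable_exp_mul_gaussianReal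
  mgf_le t := by simp only [mgf_id_gaussianReal, zero_mul, zero_add, le_refl]

theorem integral_sq_gaussianReal (v : NNReal) : ∫ z, z ^ 2 ∂(gaussianReal 0 v) = v := by
  rw [← variance_fun_id_gaussianReal (μ := 0) (v := v)]
  exact (variance_of_integral_eq_zero measurable_id.aemeasurable integral_id_gaussianReal).symm

theorem integral_uniformOn_finset {Ω : Type*} [MeasurableSpace Ω] [MeasurableSingletonClass Ω]
    (s : Finset Ω) (f : Ω → ℝ) :
    ∫ z, f z ∂(uniformOn (s : Set Ω)) = (s.card : ℝ)⁻¹ * ∑ z ∈ s, f z := by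
  have hf : IntegrableOn f s Measure.count := by
    rw [← (s : Set Ω).biUnion_of_singleton]
    exact integrableOn_finset_iUnion.2 fun z _ => integrableOn_singleton (hx := by simp)
  rw [uniformOn, ProbabilityTheory.cond, integral_smul_measure, setIntegral_finset s hf]
  simp

instance isProbabilityMeasure_uniformOn_signs :
    IsProbabilityMeasure (uniformOn ({-1, 1} : Set ℝ)) :=
  isProbabilityMeasure_uniformOn (Set.toFinite _) (Set.insert_nonempty _ _)

theorem ae_abs_eq_one_uniformOn_signs : ∀ᵐ z ∂(uniformOn ({-1, 1} : Set ℝ)), |z| = 1 := by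
  filter_upwards [ae_cond_mem (Set.toFinite ({-1, 1} : Set ℝ)).measurableSet] with z hz
  rcases hz with rfl | rfl <;> simp

theorem integral_id_uniformOn_signs : ∫ z, z ∂(uniformOn ({-1, 1} : Set ℝ)) = 0 := by
  have h := integral_uniformOn_finset ({-1, 1} : Finset ℝ) fun z => z
  rw [Finset.sum_pair (by norm_num)] at h
  simpa using h

theorem integral_sq_uniformOn_signs : ∫ z, z ^ 2 ∂(uniformOn ({-1, 1} : Set ℝ)) = 1 := by
  have h : (fun z : ℝ => z ^ 2) =ᵐ[uniformOn {-1, 1}] fun _ => 1 := by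
    filter_upwards [ae_abs_eq_one_uniformOn_signs] with z hz
    rw [← sq_abs, hz, one_pow]
  rw [integral_congr_ae h, integral_const, probReal_univ, one_smul]

theorem memLp_id_uniformOn_signs : MemLp id 2 (uniformOn ({-1, 1} : Set ℝ)) :=
  MemLp.of_bound aestronglyMeasurable_id 1 (ae_abs_eq_one_uniformOn_signs.mono fun _ hz => hz.le)

/-! ### Sums of independent variables -/

section Product

variable {ι Ω : Type*} [Fintype ι] [MeasurableSpace Ω]

theorem integral_mean_pi [Nonempty ι] (μ : Measure Ω) [IsProbabilityMeasure μ] {f : Ω → ℝ}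
    (hf : Integrable f μ) :
    ∫ ω, 1 / (Fintype.card ι : ℝ) * ∑ i, f (ω i) ∂(Measure.pi fun _ : ι => μ) = ∫ ω, f ω ∂μ := by
  have hcoord : ∀ i, ∫ ω, f (ω i) ∂(Measure.pi fun _ : ι => μ) = ∫ ω, f ω ∂μ := fun i =>
    integral_comp_eval (μ := fun _ : ι => μ) hf.aestronglyMeasurable
  rw [integral_const_mul,
    integral_finsetSum _ fun i _ => integrable_comp_eval (μ := fun _ : ι => μ) hf]
  simp only [hcoord, Finset.sum_const, Finset.card_univ, nsmul_eq_mul]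
  field_simp

theorem variance_mean_pi (μ : Measure Ω) [IsProbabilityMeasure μ] {f : Ω → ℝ} (hf : MemLp f 2 μ) :
    Var[fun ω => 1 / (Fintype.card ι : ℝ) * ∑ i, f (ω i); Measure.pi fun _ : ι => μ] =
      Var[f; μ] / Fintype.card ι := by
  have hsum := variance_sum_pi (μ := fun _ : ι => μ) (X := fun _ => f) fun _ => hf
  rw [Finset.sum_fn] at hsum
  rw [variance_const_mul, hsum, Finset.sum_const, Finset.card_univ, nsmul_eq_mul]
  rcases eq_or_ne (Fintype.card ι : ℝ) 0 with h | h
  · simp [h]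
  · field_simp

theorem measureReal_le_abs_mean_sub_le [Nonempty ι] (μ : Measure Ω) [IsProbabilityMeasure μ]
    {f : Ω → ℝ} (hf : MemLp f 2 μ) {ε : ℝ} (hε : 0 < ε) :
    (Measure.pi fun _ : ι => μ).real
      {ω | ε ≤ |1 / (Fintype.card ι : ℝ) * ∑ i, f (ω i) - ∫ ω, f ω ∂μ|} ≤
      Var[f; μ] / (Fintype.card ι * ε ^ 2) := by
  have hmem : MemLp (fun ω : ι → Ω => 1 / (Fintype.card ι : ℝ) * ∑ i, f (ω i)) 2
      (Measure.pi fun _ => μ) :=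
    (memLp_finsetSum _ fun i _ =>
      hf.comp_measurePreserving (measurePreserving_eval (fun _ => μ) i)).const_mul _
  have h := meas_ge_le_variance_div_sq hmem hε
  rw [integral_mean_pi μ (hf.integrable one_le_two), variance_mean_pi μ hf, div_div] at h
  exact ENNReal.toReal_le_of_le_ofReal (div_nonneg (variance_nonneg _ _) (by positivity)) h

variable {ν : Measure ℝ} [IsProbabilityMeasure ν]

theorem memLp_sum_mul_pi (hν : MemLp id 2 ν) (b : ι → ℝ) :
    MemLp (fun a : ι → ℝ => ∑ i, b i * a i) 2 (Measure.pi fun _ => ν) :=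
  memLp_finsetSum _ fun i _ =>
    (hν.comp_measurePreserving (measurePreserving_eval (fun _ => ν) i)).const_mul (b i)

theorem integral_sq_sum_mul_pi (hν : MemLp id 2 ν) (hmean : ∫ z, z ∂ν = 0) (b : ι → ℝ) :
    ∫ a, (∑ i, b i * a i) ^ 2 ∂(Measure.pi fun _ : ι => ν) = (∫ z, z ^ 2 ∂ν) * ∑ i, b i ^ 2 := by
  have hzero : ∫ a, ∑ i, b i * a i ∂(Measure.pi fun _ : ι => ν) = 0 := by
    rw [integral_finsetSum _ fun i _ => integrable_comp_eval (μ := fun _ : ι => ν)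
      (f := fun z => b i * z) ((hν.integrable one_le_two).const_mul _)]
    refine Finset.sum_eq_zero fun i _ => ?_
    rw [integral_const_mul, integral_comp_eval (μ := fun _ : ι => ν) (f := fun z => z)
      hν.aestronglyMeasurable, hmean, mul_zero]
  have hvar := variance_sum_pi (μ := fun _ : ι => ν) (X := fun i z => b i * z)
    fun i => hν.const_mul (b i)
  rw [Finset.sum_fn, variance_of_integral_eq_zero
    (memLp_sum_mul_pi hν b).aestronglyMeasurable.aemeasurable hzero] at hvar
  rw [hvar, Finset.mul_sum]
  refine Finset.sum_congr rfl fun i _ => ?_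
  rw [variance_const_mul,
    variance_of_integral_eq_zero (X := fun z => z) hν.aestronglyMeasurable.aemeasurable hmean,
    mul_comm]

end Product

/-! ### The random initialization -/

/-- The law of the first layer at initialization. -/
noncomputable def weightLaw (m d : ℕ) : Measure (Fin m → EuclideanSpace ℝ (Fin d)) :=
  Measure.pi fun _ => stdGaussian (EuclideanSpace ℝ (Fin d))

/-- The law of the second layer at initialization. -/
noncomputable def signLaw (m : ℕ) : Measure (Fin m → ℝ) :=
  Measure.pi fun _ => uniformOn ({-1, 1} : Set ℝ)

instance : IsProbabilityMeasure (weightLaw m d) := by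
  unfold weightLaw
  infer_instance

instance : IsProbabilityMeasure (signLaw m) := by
  unfold signLaw
  infer_instance

theorem initLaw_eq_prod : initLaw m d = (weightLaw m d).prod (signLaw m) := rfl

instance : IsProbabilityMeasure (initLaw m d) := by
  rw [initLaw_eq_prod]
  infer_instance

theorem initLaw_real_preimage_fst (s : Set (Fin m → EuclideanSpace ℝ (Fin d))) :
    (initLaw m d).real (Prod.fst ⁻¹' s) = (weightLaw m d).real s := by
  rw [initLaw_eq_prod, ← Set.prod_univ, measureReal_prod_prod, probReal_univ, mul_one]

theorem measurePreserving_preactivation {x : EuclideanSpace ℝ (Fin d)} (hx : ‖x‖ = 1) (r : Fin m) :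
    MeasurePreserving (fun W => ⟪W r, x⟫) (weightLaw m d) (gaussianReal 0 1) :=
  (measurePreserving_inner_stdGaussian hx).comp
    (measurePreserving_eval (fun _ => stdGaussian (EuclideanSpace ℝ (Fin d))) r)

theorem integral_preactivation {x : EuclideanSpace ℝ (Fin d)} (hx : ‖x‖ = 1) (r : Fin m)
    {g : ℝ → ℝ} (hg : Measurable g) :
    ∫ W, g ⟪W r, x⟫ ∂(weightLaw m d) = ∫ z, g z ∂(gaussianReal 0 1) := by
  have hmp := measurePreserving_preactivation (m := m) hx r
  rw [← hmp.map_eq, integral_map hmp.measurable.aemeasurable hg.aestronglyMeasurable]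

theorem weightLaw_real_gram_le (hx : ∀ i, ‖x i‖ ≤ 1) (hm : 0 < m) {ε : ℝ} (hε : 0 < ε) :
    (weightLaw m d).real {W | ∃ i j, ε ≤ |gramInit x W i j - gramInf x i j|} ≤
      n ^ 2 / (m * ε ^ 2) := by
  have : Nonempty (Fin m) := ⟨⟨0, hm⟩⟩
  have hentry : ∀ i j, (weightLaw m d).real {W | ε ≤ |gramInit x W i j - gramInf x i j|} ≤
      1 / (m * ε ^ 2) := fun i j => by
    have hbdd := abs_neuronGram_le_one hx (i := i) (j := j)
    have hmem : MemLp (fun w => neuronGram x w i j) 2 (stdGaussian (EuclideanSpace ℝ (Fin d))) :=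
      MemLp.of_bound (by fun_prop) 1 (Filter.Eventually.of_forall hbdd)
    have hvar := variance_le_sq_of_bounded (μ := stdGaussian (EuclideanSpace ℝ (Fin d)))
      (Filter.Eventually.of_forall fun w => abs_le.1 (hbdd w))
      (measurable_neuronGram x i j).aemeasurable
    have hdev := measureReal_le_abs_mean_sub_le (ι := Fin m) _ hmem hε
    simp only [Fintype.card_fin, ← gramInit_apply, ← gramInf_apply] at hdev
    refine hdev.trans ?_
    gcongr
    linarith
  have hset : {W : Fin m → EuclideanSpace ℝ (Fin d) |
      ∃ i j, ε ≤ |gramInit x W i j - gramInf x i j|} =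
      ⋃ p : Fin n × Fin n, {W | ε ≤ |gramInit x W p.1 p.2 - gramInf x p.1 p.2|} := by
    ext W
    simp only [Set.mem_ofPred_eq, Set.mem_iUnion, Prod.exists]
  rw [hset]
  refine (measureReal_iUnion_fintype_le _).trans
    ((Finset.sum_le_sum fun p _ => hentry p.1 p.2).trans (le_of_eq ?_))
  simp only [Finset.sum_const, Finset.card_univ, Fintype.card_prod, Fintype.card_fin, nsmul_eq_mul]
  push_cast
  ring

theorem integrable_nearZero (R : ℝ) (μ : Measure ℝ) [IsFiniteMeasure μ] :
    Integrable (nearZero R) μ :=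
  Integrable.of_bound (by fun_prop) 1 <| Filter.Eventually.of_forall fun z => by
    unfold nearZero
    split_ifs <;> simp

theorem integral_nearZero (R : ℝ) (μ : Measure ℝ) :
    ∫ z, nearZero R z ∂μ = μ.real {z | |z| ≤ R} := by
  rw [← integral_indicator_one (measurableSet_le (by fun_prop) measurable_const)]
  exact integral_congr_ae (Filter.Eventually.of_forall fun z => by
    simp [nearZero, Set.indicator])

theorem weightLaw_real_margin_le (hx : ∀ i, ‖x i‖ = 1) {R θ : ℝ} (hR : 0 ≤ R) (hθ : 0 < θ) :
    (weightLaw m d).real {W | θ ≤ ∑ r, ∑ i, nearZero R ⟪W r, x i⟫} ≤ m * n * R / θ := by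
  have hint : ∀ (r : Fin m) i, Integrable (fun W => nearZero R ⟪W r, x i⟫) (weightLaw m d) :=
    fun r i => (measurePreserving_preactivation (hx i) r).integrable_comp_of_integrable
      (integrable_nearZero R _)
  have hmean : ∫ W, ∑ r, ∑ i, nearZero R ⟪W r, x i⟫ ∂(weightLaw m d) ≤ m * n * R := by
    rw [integral_finsetSum _ fun r _ => integrable_finsetSum _ fun i _ => hint r i]
    simp only [integral_finsetSum _ fun i _ => hint _ i,
      integral_preactivation (hx _) _ (measurable_nearZero R), integral_nearZero,
      Finset.sum_const, Finset.card_univ, Fintype.card_fin, nsmul_eq_mul]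
    rw [mul_assoc]
    gcongr
    exact gaussianReal_real_abs_le_le hR
  rw [le_div_iff₀ hθ, mul_comm]
  exact (mul_meas_ge_le_integral_of_nonneg (Filter.Eventually.of_forall fun W =>
    Finset.sum_nonneg fun r _ => Finset.sum_nonneg fun i _ => nearZero_nonneg _ _)
    (integrable_finsetSum _ fun r _ => integrable_finsetSum _ fun i _ => hint r i) θ).trans hmean

theorem weightLaw_real_bound_le (hx : ∀ i, ‖x i‖ = 1) {M : ℝ} (hM : 0 ≤ M) :
    (weightLaw m d).real {W | ∃ r i, M ≤ |⟪W r, x i⟫|} ≤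
      m * n * (2 * Real.exp (-M ^ 2 / 2)) := by
  have hset : {W : Fin m → EuclideanSpace ℝ (Fin d) | ∃ r i, M ≤ |⟪W r, x i⟫|} =
      ⋃ p : Fin m × Fin n, (fun W => ⟪W p.1, x p.2⟫) ⁻¹' {z | M ≤ |z|} := by
    ext W
    simp only [Set.mem_ofPred_eq, Set.mem_iUnion, Set.mem_preimage, Prod.exists]
  have hone : ∀ p : Fin m × Fin n,
      (weightLaw m d).real ((fun W => ⟪W p.1, x p.2⟫) ⁻¹' {z | M ≤ |z|}) ≤
        2 * Real.exp (-M ^ 2 / 2) := fun p => by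
    rw [(measurePreserving_preactivation (hx p.2) p.1).measureReal_preimage
      (measurableSet_le measurable_const (by fun_prop)).nullMeasurableSet]
    simpa using measureReal_le_abs_le_of_hasSubgaussianMGF (hasSubgaussianMGF_id_gaussianReal 1) hM
  rw [hset]
  refine (measureReal_iUnion_fintype_le _).trans
    ((Finset.sum_le_sum fun p _ => hone p).trans (le_of_eq ?_))
  simp only [Finset.sum_const, Finset.card_univ, Fintype.card_prod, Fintype.card_fin, nsmul_eq_mul]
  push_cast
  ring

@[fun_prop]
theorem measurable_net (x : EuclideanSpace ℝ (Fin d)) :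
    Measurable fun p : (Fin m → EuclideanSpace ℝ (Fin d)) × (Fin m → ℝ) => net p.1 p.2 x := by
  unfold net
  fun_prop

theorem net_eq_sum (W : Fin m → EuclideanSpace ℝ (Fin d)) (a : Fin m → ℝ)
    (x : EuclideanSpace ℝ (Fin d)) :
    net W a x = ∑ r, 1 / Real.sqrt m * relu ⟪W r, x⟫ * a r := by
  rw [net, Finset.mul_sum]
  exact Finset.sum_congr rfl fun r _ => by ring

theorem integrable_net_sq_signLaw (W : Fin m → EuclideanSpace ℝ (Fin d))
    (x : EuclideanSpace ℝ (Fin d)) : Integrable (fun a => net W a x ^ 2) (signLaw m) := by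
  simp only [net_eq_sum]
  exact (memLp_sum_mul_pi memLp_id_uniformOn_signs _).integrable_sq

theorem integral_net_sq_signLaw (W : Fin m → EuclideanSpace ℝ (Fin d))
    (x : EuclideanSpace ℝ (Fin d)) :
    ∫ a, net W a x ^ 2 ∂(signLaw m) = 1 / m * ∑ r, relu ⟪W r, x⟫ ^ 2 := by
  simp only [net_eq_sum, signLaw]
  rw [integral_sq_sum_mul_pi memLp_id_uniformOn_signs integral_id_uniformOn_signs,
    integral_sq_uniformOn_signs, one_mul, Finset.mul_sum]
  refine Finset.sum_congr rfl fun r _ => ?_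
  rw [mul_pow, div_pow, one_pow, Real.sq_sqrt (Nat.cast_nonneg m)]

theorem integrable_relu_sq_gaussianReal (v : NNReal) :
    Integrable (fun z => relu z ^ 2) (gaussianReal 0 v) :=
  (IsGaussian.memLp_two_id.mono (by fun_prop)
    (Filter.Eventually.of_forall abs_relu_le)).integrable_sq

theorem integral_relu_sq_gaussianReal_le (v : NNReal) :
    ∫ z, relu z ^ 2 ∂(gaussianReal 0 v) ≤ v := by
  rw [← integral_sq_gaussianReal v]
  exact integral_mono (integrable_relu_sq_gaussianReal v) IsGaussian.memLp_two_id.integrable_sq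
    fun z => sq_le_sq.2 (abs_relu_le z)

theorem integrable_relu_sq_weightLaw {x : EuclideanSpace ℝ (Fin d)} (hx : ‖x‖ = 1) (r : Fin m) :
    Integrable (fun W => relu ⟪W r, x⟫ ^ 2) (weightLaw m d) :=
  (measurePreserving_preactivation hx r).integrable_comp_of_integrable
    (integrable_relu_sq_gaussianReal 1)

theorem integrable_net_sq_initLaw {x : EuclideanSpace ℝ (Fin d)} (hx : ‖x‖ = 1) :
    Integrable (fun p => net p.1 p.2 x ^ 2) (initLaw m d) := by
  rw [initLaw_eq_prod, integrable_prod_iff (by fun_prop)]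
  refine ⟨Filter.Eventually.of_forall fun W => integrable_net_sq_signLaw W x, ?_⟩
  simp only [norm_pow, Real.norm_eq_abs, sq_abs, integral_net_sq_signLaw]
  exact (integrable_finsetSum _ fun r _ => integrable_relu_sq_weightLaw hx r).const_mul _

theorem integral_net_sq_initLaw_le_one {x : EuclideanSpace ℝ (Fin d)} (hx : ‖x‖ = 1) :
    ∫ p, net p.1 p.2 x ^ 2 ∂(initLaw m d) ≤ 1 := by
  have hint := integrable_net_sq_initLaw (m := m) hx
  rw [initLaw_eq_prod] at hint ⊢
  rw [integral_prod _ hint]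
  simp only [integral_net_sq_signLaw]
  rw [integral_const_mul, integral_finsetSum _ fun r _ => integrable_relu_sq_weightLaw hx r]
  simp only [integral_preactivation hx _ (g := fun z => relu z ^ 2) (by fun_prop),
    Finset.sum_const, Finset.card_univ, Fintype.card_fin, nsmul_eq_mul]
  rw [← mul_assoc]
  exact mul_le_one₀ (by rw [one_div]; exact inv_mul_le_one)
    (integral_nonneg fun z => sq_nonneg _) (integral_relu_sq_gaussianReal_le 1)

theorem initLaw_real_output_le (hx : ∀ i, ‖x i‖ = 1) {S : ℝ} (hS : 0 < S) :
    (initLaw m d).real {p | S ≤ ∑ i, net p.1 p.2 (x i) ^ 2} ≤ n / S := by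
  have hint := fun i (_ : i ∈ Finset.univ) => integrable_net_sq_initLaw (m := m) (hx i)
  have hmean : ∫ p, ∑ i, net p.1 p.2 (x i) ^ 2 ∂(initLaw m d) ≤ n := by
    rw [integral_finsetSum _ hint]
    exact (Finset.sum_le_sum fun i _ => integral_net_sq_initLaw_le_one (hx i)).trans (by simp)
  rw [le_div_iff₀ hS, mul_comm]
  exact (mul_meas_ge_le_integral_of_nonneg
    (Filter.Eventually.of_forall fun p => Finset.sum_nonneg fun i _ => sq_nonneg _)
    (integrable_finsetSum _ hint) S).trans hmean

theorem initLaw_real_sign : (initLaw m d).real {p | ∃ r, |p.2 r| ≠ 1} = 0 := by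
  have hsigns : ∀ᵐ a ∂(signLaw m), ∀ r, |a r| = 1 := ae_all_iff.2 fun r =>
    (measurePreserving_eval (fun _ => uniformOn ({-1, 1} : Set ℝ)) r).quasiMeasurePreserving.ae
      ae_abs_eq_one_uniformOn_signs
  have hpair : ∀ᵐ p ∂(initLaw m d), ∀ r, |p.2 r| = 1 :=
    (measurePreserving_snd (μ := weightLaw m d)).quasiMeasurePreserving.ae hsigns
  rw [ae_iff] at hpair
  simp only [not_forall] at hpair
  rw [measureReal_def, hpair, ENNReal.toReal_zero]

theorem measurableSet_isGoodInit (x : Fin n → EuclideanSpace ℝ (Fin d)) (m : ℕ) (R M S : ℝ) :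
    MeasurableSet {p : (Fin m → EuclideanSpace ℝ (Fin d)) × (Fin m → ℝ) |
      IsGoodInit x R M S p.1 p.2} := by
  have hset : {p : (Fin m → EuclideanSpace ℝ (Fin d)) × (Fin m → ℝ) |
      IsGoodInit x R M S p.1 p.2} =
      (⋂ r, {p | |p.2 r| = 1}) ∩
      ((⋂ i, ⋂ j, {p | |gramInit x p.1 i j - gramInf x i j| < lambdaMin (gramInf x) / (8 * n)}) ∩
      ({p | ∑ r, ∑ i, nearZero R ⟪p.1 r, x i⟫ < m * lambdaMin (gramInf x) / (16 * n)} ∩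
      ((⋂ r, ⋂ i, {p | |⟪p.1 r, x i⟫| < M}) ∩
      {p | ∑ i, net p.1 p.2 (x i) ^ 2 < S}))) := by
    ext p
    simp only [Set.mem_inter_iff, Set.mem_iInter, Set.mem_ofPred_eq]
    exact ⟨fun h => ⟨h.1, h.2, h.3, h.4, h.5⟩, fun h => ⟨h.1, h.2.1, h.2.2.1, h.2.2.2.1, h.2.2.2.2⟩⟩
  rw [hset]
  simp only [gramInit_apply]
  refine .inter (.iInter fun r => measurableSet_eq_fun (by fun_prop) measurable_const) <|
    .inter (.iInter fun i => .iInter fun j => measurableSet_lt ?_ measurable_const) <|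
    .inter (measurableSet_lt ?_ measurable_const) <|
    .inter (.iInter fun r => .iInter fun i => measurableSet_lt (by fun_prop) measurable_const) <|
    measurableSet_lt (by fun_prop) measurable_const
  · fun_prop
  · fun_prop

theorem initLaw_real_not_isGoodInit_le (hn : 0 < n) (hm : 0 < m)
    (hlam : 0 < lambdaMin (gramInf x)) (hx : ∀ i, ‖x i‖ = 1) {R M S : ℝ} (hR : 0 ≤ R) (hM : 0 ≤ M)
    (hS : 0 < S) :
    (initLaw m d).real {p | ¬IsGoodInit x R M S p.1 p.2} ≤
      64 * n ^ 4 / (m * lambdaMin (gramInf x) ^ 2) + 16 * n ^ 2 * R / lambdaMin (gramInf x) +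
        m * n * (2 * Real.exp (-M ^ 2 / 2)) + n / S := by
  set lam := lambdaMin (gramInf x)
  set gramBad : Set (Fin m → EuclideanSpace ℝ (Fin d)) :=
    {W | ∃ i j, lam / (8 * n) ≤ |gramInit x W i j - gramInf x i j|}
  set marginBad : Set (Fin m → EuclideanSpace ℝ (Fin d)) :=
    {W | m * lam / (16 * n) ≤ ∑ r, ∑ i, nearZero R ⟪W r, x i⟫}
  set boundBad : Set (Fin m → EuclideanSpace ℝ (Fin d)) := {W | ∃ r i, M ≤ |⟪W r, x i⟫|}
  set outputBad : Set ((Fin m → EuclideanSpace ℝ (Fin d)) × (Fin m → ℝ)) :=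
    {p | S ≤ ∑ i, net p.1 p.2 (x i) ^ 2}
  set signBad : Set ((Fin m → EuclideanSpace ℝ (Fin d)) × (Fin m → ℝ)) :=
    {p | ∃ r, |p.2 r| ≠ 1}
  have hcover : {p | ¬IsGoodInit x R M S p.1 p.2} ⊆ Prod.fst ⁻¹' gramBad ∪
      Prod.fst ⁻¹' marginBad ∪ Prod.fst ⁻¹' boundBad ∪ outputBad ∪ signBad := by
    intro p hp
    contrapose! hp
    simp only [gramBad, marginBad, boundBad, outputBad, signBad, Set.mem_union, Set.mem_preimage,
      Set.mem_ofPred_eq, not_or, not_exists, not_le, not_not] at hp ⊢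
    obtain ⟨⟨⟨⟨hgram, hmargin⟩, hbound⟩, houtput⟩, hsign⟩ := hp
    exact ⟨hsign, hgram, hmargin, hbound, houtput⟩
  have _ : (0 : ℝ) < n := by exact_mod_cast hn
  have _ : (0 : ℝ) < m := by exact_mod_cast hm
  have hgram : (weightLaw m d).real gramBad ≤ 64 * n ^ 4 / (m * lam ^ 2) :=
    (weightLaw_real_gram_le (fun i => (hx i).le) hm (by positivity)).trans_eq (by field_simp; ring)
  have hmargin : (weightLaw m d).real marginBad ≤ 16 * n ^ 2 * R / lam :=
    (weightLaw_real_margin_le hx hR (by positivity)).trans_eq (by field_simp)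
  have hbound : (weightLaw m d).real boundBad ≤ _ := weightLaw_real_bound_le hx hM
  have houtput : (initLaw m d).real outputBad ≤ n / S := initLaw_real_output_le hx hS
  have hsign : (initLaw m d).real signBad = 0 := initLaw_real_sign
  refine (measureReal_mono hcover).trans ?_
  grw [measureReal_union_le, measureReal_union_le, measureReal_union_le, measureReal_union_le]
  simp only [initLaw_real_preimage_fst]
  linarith

/-! ### Consequences of the size of the width -/

theorem mul_two_mul_exp_neg_three_sqrt_log_sq_le {q : ℝ} (hq : 2 ≤ q) :
    q * (2 * Real.exp (-(3 * Real.sqrt (Real.log q)) ^ 2 / 2)) ≤ 1 / 4 := by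
  have hq0 : 0 < q := by linarith
  have hlog : 0 ≤ Real.log q := Real.log_nonneg (by linarith)
  have hexp : Real.exp (-(3 * Real.sqrt (Real.log q)) ^ 2 / 2) ≤ (q ^ 4)⁻¹ := by
    rw [← Real.exp_log (inv_pos.2 (pow_pos hq0 4)), Real.exp_le_exp, Real.log_inv, Real.log_pow,
      mul_pow, Real.sq_sqrt hlog]
    push_cast
    linarith
  have hcube : (2 : ℝ) ^ 3 ≤ q ^ 3 := by gcongr
  calc q * (2 * Real.exp (-(3 * Real.sqrt (Real.log q)) ^ 2 / 2)) ≤ q * (2 * (q ^ 4)⁻¹) := by gcongr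
    _ = 2 / q ^ 3 := by field_simp
    _ ≤ 2 / 2 ^ 3 := by gcongr
    _ = 1 / 4 := by norm_num

theorem norm_sub_prediction_sq_le {C δ : ℝ} (hδ : 0 < δ) (hδ1 : δ ≤ 1) (hy : ∀ i, |y i| ≤ C)
    {W : Fin m → EuclideanSpace ℝ (Fin d)} {a : Fin m → ℝ}
    (h : ∑ i, net W a (x i) ^ 2 ≤ 4 * n / δ) :
    ‖y - prediction x W a‖ ^ 2 ≤ 8 * (1 + C ^ 2) * n / δ := by
  have hterm : ∀ i, (net W a (x i) - y i) ^ 2 ≤ 2 * net W a (x i) ^ 2 + 2 * C ^ 2 := fun i => by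
    have hC : y i ^ 2 ≤ C ^ 2 := sq_le_sq.2 ((hy i).trans (le_abs_self C))
    linarith [sq_nonneg (net W a (x i) + y i)]
  calc ‖y - prediction x W a‖ ^ 2 = ∑ i, (net W a (x i) - y i) ^ 2 := by
        rw [norm_sub_rev, norm_prediction_sub_sq]
    _ ≤ ∑ i, (2 * net W a (x i) ^ 2 + 2 * C ^ 2) := Finset.sum_le_sum fun i _ => hterm i
    _ = 2 * ∑ i, net W a (x i) ^ 2 + 2 * (n * C ^ 2) := by
        rw [Finset.sum_add_distrib, ← Finset.mul_sum, Finset.sum_const, Finset.card_univ,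
          Fintype.card_fin, nsmul_eq_mul]
        ring
    _ ≤ 2 * (4 * n / δ) + 2 * (4 * (n * C ^ 2) / δ) := by
        gcongr
        rw [le_div_iff₀ hδ]
        nlinarith [mul_nonneg (Nat.cast_nonneg (α := ℝ) n) (sq_nonneg C)]
    _ = 8 * (1 + C ^ 2) * n / δ := by ring

/-- The quantitative assumptions on the width `m`: with `lam` the least eigenvalue of the limiting
Gram matrix and `B * n / δ` a bound for the squared initial residual, `m` is large enough for the
theorem to hold with failure probability `δ`. -/
structure IsWide (n m : ℕ) (lam δ B : ℝ) : Prop where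
  samples_pos : 0 < n
  two_le : 2 ≤ m
  lam_pos : 0 < lam
  lam_le_one : lam ≤ 1
  δ_pos : 0 < δ
  δ_lt_one : δ < 1
  eight_le : 8 ≤ B
  width : 2 ^ 18 * B * (n ^ 6 * Real.log (m / δ) / (lam ^ 4 * δ ^ 3)) ≤ m

namespace IsWide

variable {lam δ B : ℝ}

theorem one_le_samples (h : IsWide n m lam δ B) : (1 : ℝ) ≤ n := by exact_mod_cast h.samples_pos

theorem width_pos (h : IsWide n m lam δ B) : (0 : ℝ) < m := by
  exact_mod_cast two_pos.trans_le h.two_le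

theorem two_le_div (h : IsWide n m lam δ B) : (2 : ℝ) ≤ m / δ :=
  have hm : (2 : ℝ) ≤ m := by exact_mod_cast h.two_le
  hm.trans (le_div_self h.width_pos.le h.δ_pos h.δ_lt_one.le)

theorem div_le_mul_div (h : IsWide n m lam δ B) : m / δ ≤ m * n / δ := by
  have hδ := h.δ_pos
  gcongr
  exact le_mul_of_one_le_right h.width_pos.le h.one_le_samples

theorem half_le_log (h : IsWide n m lam δ B) : 1 / 2 ≤ Real.log (m / δ) :=
  (by linarith [Real.log_two_gt_d9] : 1 / 2 ≤ Real.log 2).trans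
    (Real.log_le_log two_pos h.two_le_div)

theorem half_le_log_mul (h : IsWide n m lam δ B) : 1 / 2 ≤ Real.log (m * n / δ) :=
  h.half_le_log.trans (Real.log_le_log (two_pos.trans_le h.two_le_div) h.div_le_mul_div)

theorem mul_pow_six_mul_log_le (h : IsWide n m lam δ B) :
    2 ^ 18 * B * n ^ 6 * Real.log (m / δ) ≤ m * lam ^ 4 * δ ^ 3 := by
  have hlam := h.lam_pos
  have hδ := h.δ_pos
  have hwidth := h.width
  rw [← mul_div_assoc, div_le_iff₀ (by positivity)] at hwidth
  linarith

theorem pow_four_mul_pow_three_le (h : IsWide n m lam δ B) :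
    m * lam ^ 4 * δ ^ 3 ≤ m * lam ^ 2 * δ := by
  have hlam := h.lam_pos
  have hδ := h.δ_pos
  have hlam4 : lam ^ 4 ≤ lam ^ 2 := pow_le_pow_of_le_one hlam.le h.lam_le_one (by norm_num)
  have hδ3 : δ ^ 3 ≤ δ := pow_le_of_le_one hδ.le h.δ_lt_one.le (by norm_num)
  gcongr

theorem mul_pow_six_lt (h : IsWide n m lam δ B) :
    65536 * B * n ^ 6 < m * lam ^ 4 * δ ^ 3 := by
  have hn := h.one_le_samples
  have hB := h.eight_le
  have hpos : 0 < B * n ^ 6 := by positivity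
  refine lt_of_lt_of_le ?_ h.mul_pow_six_mul_log_le
  calc 65536 * B * n ^ 6 < 2 ^ 18 * B * n ^ 6 * (1 / 2) := by linarith
    _ ≤ 2 ^ 18 * B * n ^ 6 * Real.log (m / δ) := by gcongr; exact h.half_le_log

theorem mul_sq_mul_log_lt (h : IsWide n m lam δ B) :
    8192 * B * n ^ 2 * Real.log (m / δ) < m * lam ^ 2 * δ := by
  have hn := h.one_le_samples
  have hB := h.eight_le
  have hlog := h.half_le_log
  calc 8192 * B * n ^ 2 * Real.log (m / δ) < 2 ^ 18 * B * n ^ 2 * Real.log (m / δ) := by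
        gcongr
        norm_num
    _ ≤ 2 ^ 18 * B * n ^ 6 * Real.log (m / δ) := by
        gcongr
        norm_num
    _ ≤ m * lam ^ 2 * δ := h.mul_pow_six_mul_log_le.trans h.pow_four_mul_pow_three_le

theorem pow_four_le (h : IsWide n m lam δ B) : 256 * n ^ 4 ≤ m * lam ^ 2 * δ := by
  have hn := h.one_le_samples
  have hpow : (n : ℝ) ^ 4 ≤ n ^ 6 := pow_le_pow_right₀ hn (by norm_num)
  have hB : 8 * (n : ℝ) ^ 6 ≤ B * n ^ 6 := by gcongr; exact h.eight_le
  have hpos : (0 : ℝ) < n ^ 4 := by positivity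
  linarith [h.mul_pow_six_lt, h.pow_four_mul_pow_three_le]

theorem samples_le_width (h : IsWide n m lam δ B) : (n : ℝ) ≤ m := by
  have hlam := h.lam_pos
  have hpow : (n : ℝ) ≤ n ^ 4 := le_self_pow₀ h.one_le_samples (by norm_num)
  have hlam2 : lam ^ 2 ≤ 1 := pow_le_one₀ hlam.le h.lam_le_one
  calc (n : ℝ) ≤ 256 * n ^ 4 := by linarith [h.one_le_samples]
    _ ≤ m * lam ^ 2 * δ := h.pow_four_le
    _ ≤ m * 1 * 1 := by gcongr; exacts [h.δ_pos.le, h.δ_lt_one.le]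
    _ = m := by ring

theorem log_mul_le (h : IsWide n m lam δ B) :
    Real.log (m * n / δ) ≤ 2 * Real.log (m / δ) := by
  have hn := h.one_le_samples
  have hquot : (n : ℝ) ≤ m / δ :=
    h.samples_le_width.trans (le_div_self h.width_pos.le h.δ_pos h.δ_lt_one.le)
  have hquot_pos := two_pos.trans_le h.two_le_div
  rw [mul_div_right_comm, Real.log_mul hquot_pos.ne' (by positivity), two_mul]
  gcongr

theorem three_mul_sqrt_log_add_le (h : IsWide n m lam δ B) :
    3 * Real.sqrt (Real.log (m * n / δ)) + δ * lam / (64 * n ^ 2) ≤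
      4 * Real.sqrt (Real.log (m * n / δ)) := by
  have hradius : δ * lam / (64 * n ^ 2) ≤ 1 / 64 := by
    have hn2 : (1 : ℝ) ≤ n ^ 2 := one_le_pow₀ h.one_le_samples
    have hprod : δ * lam ≤ 1 := mul_le_one₀ h.δ_lt_one.le h.lam_pos.le h.lam_le_one
    gcongr
    linarith
  have hsqrt : 1 / 64 ≤ Real.sqrt (Real.log (m * n / δ)) :=
    Real.le_sqrt_of_sq_le (by linarith [h.half_le_log_mul])
  linarith

theorem weight_radius_lt (h : IsWide n m lam δ B) {D : ℝ} (hD : D ^ 2 ≤ B * n / δ) :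
    4 * Real.sqrt n * D / (Real.sqrt m * lam) < δ * lam / (64 * n ^ 2) := by
  have hn := h.one_le_samples
  have hm := h.width_pos
  have hlam := h.lam_pos
  have hδ := h.δ_pos
  rw [le_div_iff₀ hδ] at hD
  refine lt_of_pow_lt_pow_left₀ 2 (by positivity) ?_
  rw [div_pow, div_pow, mul_pow, mul_pow, mul_pow _ lam, Real.sq_sqrt (by positivity),
    Real.sq_sqrt hm.le, div_lt_div_iff₀ (by positivity) (by positivity)]
  refine lt_of_mul_lt_mul_right (a := δ) ?_ hδ.le
  calc 4 ^ 2 * n * D ^ 2 * (64 * n ^ 2) ^ 2 * δ = 65536 * n ^ 5 * (D ^ 2 * δ) := by ring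
    _ ≤ 65536 * n ^ 5 * (B * n) := by gcongr
    _ = 65536 * B * n ^ 6 := by ring
    _ < m * lam ^ 4 * δ ^ 3 := h.mul_pow_six_lt
    _ = _ := by ring

theorem sign_radius_lt (h : IsWide n m lam δ B) {D : ℝ} (hD : D ^ 2 ≤ B * n / δ) :
    8 * Real.sqrt n * D * Real.sqrt (Real.log (m * n / δ)) / (Real.sqrt m * lam) < 1 / 8 := by
  have hn := h.one_le_samples
  have hm := h.width_pos
  have hlam := h.lam_pos
  have hδ := h.δ_pos
  have hB := h.eight_le
  have hlog := h.half_le_log_mul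
  rw [le_div_iff₀ hδ] at hD
  refine lt_of_pow_lt_pow_left₀ 2 (by positivity) ?_
  rw [div_pow, mul_pow, mul_pow, mul_pow, mul_pow _ lam, Real.sq_sqrt (by positivity),
    Real.sq_sqrt hm.le, Real.sq_sqrt (by linarith), div_pow, one_pow,
    div_lt_div_iff₀ (by positivity) (by positivity)]
  refine lt_of_mul_lt_mul_right (a := δ) ?_ hδ.le
  calc 8 ^ 2 * n * D ^ 2 * Real.log (m * n / δ) * 8 ^ 2 * δ
      = 4096 * n * Real.log (m * n / δ) * (D ^ 2 * δ) := by ring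
    _ ≤ 4096 * n * Real.log (m * n / δ) * (B * n) := by gcongr
    _ ≤ 4096 * n * (2 * Real.log (m / δ)) * (B * n) := by gcongr; exact h.log_mul_le
    _ = 8192 * B * n ^ 2 * Real.log (m / δ) := by ring
    _ < m * lam ^ 2 * δ := h.mul_sq_mul_log_lt
    _ = _ := by ring

theorem failureProbability_le (h : IsWide n m (lambdaMin (gramInf x)) δ B)
    (hx : ∀ i, ‖x i‖ = 1) :
    (initLaw m d).real {p | ¬IsGoodInit x (δ * lambdaMin (gramInf x) / (64 * n ^ 2))
      (3 * Real.sqrt (Real.log (m * n / δ))) (4 * n / δ) p.1 p.2} ≤ δ := by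
  have hn := h.one_le_samples
  have hm := h.width_pos
  have hlam := h.lam_pos
  have hδ := h.δ_pos
  refine (initLaw_real_not_isGoodInit_le h.samples_pos (by exact_mod_cast hm) hlam hx
    (by positivity) (by positivity) (by positivity)).trans ?_
  set lam := lambdaMin (gramInf x)
  have hgram : 64 * n ^ 4 / (m * lam ^ 2) ≤ δ / 4 := by
    rw [div_le_div_iff₀ (by positivity) (by norm_num)]
    linarith [h.pow_four_le]
  have hmargin : 16 * n ^ 2 * (δ * lam / (64 * n ^ 2)) / lam = δ / 4 := by
    field_simp
    norm_num
  have hbound : m * n * (2 * Real.exp (-(3 * Real.sqrt (Real.log (m * n / δ))) ^ 2 / 2)) ≤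
      δ / 4 := by
    have htail := mul_two_mul_exp_neg_three_sqrt_log_sq_le (h.two_le_div.trans h.div_le_mul_div)
    rw [div_mul_eq_mul_div, div_le_iff₀ hδ] at htail
    linarith
  have houtput : n / (4 * n / δ) = δ / 4 := by field_simp
  linarith

theorem one_sub_le_initLaw_isGoodInit (h : IsWide n m (lambdaMin (gramInf x)) δ B)
    (hx : ∀ i, ‖x i‖ = 1) :
    ENNReal.ofReal (1 - δ) ≤
      initLaw m d {p | IsGoodInit x (δ * lambdaMin (gramInf x) / (64 * n ^ 2))
        (3 * Real.sqrt (Real.log (m * n / δ))) (4 * n / δ) p.1 p.2} := by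
  rw [← ofReal_measureReal]
  have hcompl := probReal_compl_eq_one_sub (μ := initLaw m d) (measurableSet_isGoodInit x m
    (δ * lambdaMin (gramInf x) / (64 * n ^ 2)) (3 * Real.sqrt (Real.log (m * n / δ))) (4 * n / δ))
  have hbad := h.failureProbability_le hx
  rw [Set.compl_ofPred] at hcompl
  exact ENNReal.ofReal_le_ofReal (by linarith)

end IsWide

end TwoLayerReLU

theorem theorem3p3 (C : ℝ) :
    ∃ K : ℝ, 0 < K ∧
      ∀ (n d m : ℕ) (x : Fin n → EuclideanSpace ℝ (Fin d)) (y : EuclideanSpace ℝ (Fin n))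
        (lam0 δ : ℝ),
        0 < n → 2 ≤ m → 0 < δ → δ < 1 →
        (∀ i, ‖x i‖ = 1) → (∀ i, |y i| ≤ C) →
        lam0 = TwoLayerReLU.lambdaMin (TwoLayerReLU.gramInf x) → 0 < lam0 →
        K * ((n : ℝ) ^ 6 * Real.log (m / δ) / (lam0 ^ 4 * δ ^ 3)) ≤ m →
        ∃ E : Set ((Fin m → EuclideanSpace ℝ (Fin d)) × (Fin m → ℝ)),
          MeasurableSet E ∧
          ENNReal.ofReal (1 - δ) ≤ TwoLayerReLU.initLaw m d E ∧
          ∀ (T : ℝ) (W : ℝ → Fin m → EuclideanSpace ℝ (Fin d)) (a : ℝ → Fin m → ℝ),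
            0 ≤ T → (W 0, a 0) ∈ E → TwoLayerReLU.IsGradientFlow x y T W a →
            ∀ t ∈ Set.Icc (0 : ℝ) T,
              ‖TwoLayerReLU.prediction x (W t) (a t) - y‖ ^ 2 ≤
                  Real.exp (-lam0 * t) * ‖TwoLayerReLU.prediction x (W 0) (a 0) - y‖ ^ 2 ∧
              (∀ r, ‖W t r - W 0 r‖ ≤
                4 * Real.sqrt n * ‖y - TwoLayerReLU.prediction x (W 0) (a 0)‖ /
                  (Real.sqrt m * lam0)) ∧
              (∀ r, |a t r - a 0 r| ≤
                8 * Real.sqrt n * ‖y - TwoLayerReLU.prediction x (W 0) (a 0)‖ *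
                    Real.sqrt (Real.log (m * n / δ)) /
                  (Real.sqrt m * lam0)) := by
  refine ⟨2 ^ 18 * (8 * (1 + C ^ 2)), by positivity, ?_⟩
  rintro n d m x y _ δ hn hm hδ hδ1 hx hy rfl hlam hwidth
  have hwide : TwoLayerReLU.IsWide n m (TwoLayerReLU.lambdaMin (TwoLayerReLU.gramInf x)) δ
      (8 * (1 + C ^ 2)) :=
    { samples_pos := hn
      two_le := hm
      lam_pos := hlam
      lam_le_one := TwoLayerReLU.lambdaMin_gramInf_le_one (fun i => (hx i).le) hn
      δ_pos := hδ
      δ_lt_one := hδ1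
      eight_le := by linarith [sq_nonneg C]
      width := hwidth }
  refine ⟨_, TwoLayerReLU.measurableSet_isGoodInit x m _ _ _,
    hwide.one_sub_le_initLaw_isGoodInit hx, fun T W a _ hgood hflow t ht => ?_⟩
  have hres := TwoLayerReLU.norm_sub_prediction_sq_le hδ hδ1.le hy hgood.output.le
  exact hgood.flowBounds hn (by omega) hlam (fun i => (hx i).le) hwide.three_mul_sqrt_log_add_le
    (Real.sqrt_nonneg _) (hwide.weight_radius_lt hres) (hwide.sign_radius_lt hres) hflow ht
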